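/- **Setting.** Let $n\ge 3$, let $t_1<\dots<t_n$ be real numbers and $t_\infty=\infty$; these $n+1$ points of $\mathbb R\cup\{\infty\}$, the boundary of the upper half-plane, are called vertices. Two orthodisks on this conformal polygon are given by odd integers $a_v$ and $b_v$, one pair for each vertex $v\in\{1,\dots,n,\infty\}$, with $a_\infty=-4-\sum_{i=1}^n a_i$ and $b_\infty=-4-\sum_{i=1}^n b_i$; they are the flat metrics pulled back by the Schwarz–Christoffel maps $\int\prod(t-t_i)^{a_i/2}dt$ and $\int\prod(t-t_i)^{b_i/2}dt$. (As $a_\infty$ is odd, $n$ is odd.) Let $Z$ be the compact hyperelliptic Riemann surface $y^2=\prod_{i=1}^n(t-t_i)$; it has one point $p_v$ over each vertex $t_v$. A vertex $v$ is called infinite if $a_v\le-2$ or $b_v\le -2$. A *minimal surface given by the two orthodisks* consists of a meromorphic function $G$ and a meromorphic $1$-form $dh$ on $Z$ such that, for some non-zero complex constants $c_1,c_2$, $$G\,dh=c_1\,y\prod_{i=1}^n(t-t_i)^{(a_i-1)/2}\,dt,\qquad G^{-1}dh=c_2\,y\prod_{i=1}^n(t-t_i)^{(b_i-1)/2}\,dt$$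 (the lifts to $Z$ of the Schwarz–Christoffel forms), together with a single-valued continuous map $X:Z\setminus\{p_v: v\text{ infinite}\}\to\mathbb R^3$ satisfying $$dX=\operatorname{Re}\Bigl(\tfrac12(G-G^{-1})\,dh,\ \tfrac i2(G+G^{-1})\,dh,\ dh\Bigr).$$ The points $p_v$, $v$ infinite, are its ends. A vertex $v$ is called a catenoid vertex if $\{a_v,b_v\}=\{-3,-1\}$, and a planar vertex if $\{a_v,b_v\}=\{-3,3\}$. An end is *planar or catenoidal, with unit normal $\nu$, growth rate $\alpha$ and height $\beta$*, if $X$ maps a punctured neighbourhood of it bijectively onto the graph, over the exterior of a disc in the plane $\nu^\perp$, of a function $u(x)=\alpha\log|x|+\beta+o(1)$ as $|x|\to\infty$, where $x\in\nu^\perp$ tends to infinity as the end is approached. It is planar if $\alpha=0$, and catenoidal, opening in direction $\nu$ (resp. $-\nu$), if $\alpha>0$ (resp. $\alpha<0$). A surface is *eventually embedded* if all its ends are planar or catenoidal with a common normal $\nu$, different planar ends have different heights, and different catenoid ends opening in the same direction have different growth rates (so that the higher one has the larger growth rate). **Theorem 9.2.** Suppose that there is a minimal surface given by two orthodisks such that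 for all vertices $v$, including $v=\infty$, 1. $a_v,b_v\in\{-3,-1,1,3\}$, 2. $2+a_v+b_v\le|a_v-b_v|$, 3. $a_v+b_v\equiv0\pmod 2$. (Condition 2 says that the surface is complete; its total curvature is finite because $G$ is meromorphic on the compact surface $Z$.) Suppose that there are exactly two catenoid vertices, and that all planar vertices lie in a single connected component of $\mathbb R\cup\{\infty\}$ with the two catenoid vertices removed. Then the surface is eventually embedded. Moreover the two catenoid vertices are catenoid ends with parallel axes, one opening in some direction $\nu$ and the other in the direction $-\nu$. -/

import Mathlib

open Filter Topology

/-- A conformal polygon: the upper half-plane together with `n ≥ 3` distinguished real points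
`t 0 < t 1 < ⋯ < t (n-1)`; the point `∞` is a further distinguished point. -/
structure ConformalPolygon (n : ℕ) where
  t : Fin n → ℝ
  strictMono_t : StrictMono t
  three_le : 3 ≤ n

namespace ConformalPolygon

variable {n : ℕ}

/-- The affine hyperelliptic curve `y ^ 2 = ∏ (t - t_i)`, with points `(t, y)`: the double cover,
branched over the vertices, of the double `ℂ ∪ {∞}` of the closed upper half-plane, with its point
over `∞` left out (for odd `n` there is exactly one such point). -/
abbrev AffineCurve (P : ConformalPolygon n) : Type :=
  {p : ℂ × ℂ // p.2 ^ 2 = ∏ i, (p.1 - (P.t i : ℂ))}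

/-- The compact hyperelliptic surface. For odd `n`, which is forced as soon as the polygon carries
an orthodisk, it is the affine curve together with the one point over `∞`. -/
abbrev Curve (P : ConformalPolygon n) : Type := OnePoint P.AffineCurve

/-- The vertices of the polygon: `some i` is `t_i` and `none` is `∞`. The point of the compact
surface over a vertex. -/
def vertexPoint (P : ConformalPolygon n) : Option (Fin n) → P.Curve
  | none => OnePoint.infty
  | some i => ((⟨((P.t i : ℂ), 0), by
      rw [Finset.prod_eq_zero (Finset.mem_univ i) (sub_self _), zero_pow two_ne_zero]⟩ : P.AffineCurve) :
        OnePoint P.AffineCurve)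

/-- The position of a vertex on the boundary `ℝ ∪ {∞}` of the upper half-plane. -/
def boundaryPoint (P : ConformalPolygon n) : Option (Fin n) → OnePoint ℝ
  | none => OnePoint.infty
  | some i => (P.t i : OnePoint ℝ)

/-- `s` is, near `t₀`, a continuous section `t ↦ (t, y(t))` of the double cover, and `t₀` is not
a vertex. In other words, `s` is the inverse of the local coordinate `t` of the Riemann surface
near the point `s t₀`. Away from the vertices `t` is a local coordinate everywhere. -/
def IsLocalSection (P : ConformalPolygon n) (s : ℂ → P.AffineCurve) (t₀ : ℂ) : Prop :=
  (s t₀).1.2 ≠ 0 ∧ ContinuousAt s t₀ ∧ ∀ᶠ t in 𝓝 t₀, (s t).1.1 = t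

/-- `f` is holomorphic on the surface without the points over the vertices. -/
def HolomorphicOffVertices (P : ConformalPolygon n) (f : P.AffineCurve → ℂ) : Prop :=
  ∀ (t₀ : ℂ) (s : ℂ → P.AffineCurve), P.IsLocalSection s t₀ →
    DifferentiableAt ℂ (fun t => f (s t)) t₀

end ConformalPolygon

/-- An orthodisk on a conformal polygon, given by its vertex data: odd integers `a_v`, one for each
vertex (including `∞`), with `a_∞ = -4 - ∑ a_i`. The flat metric is the pull-back of the metric
of `ℂ` by the Schwarz-Christoffel map `z ↦ ∫ ∏ (t - t_i) ^ (a_i / 2) dt`. -/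
structure Orthodisk {n : ℕ} (P : ConformalPolygon n) where
  data : Option (Fin n) → ℤ
  odd_data : ∀ v, Odd (data v)
  data_infty : data none = -4 - ∑ i, data (some i)

namespace Orthodisk

variable {n : ℕ} {P : ConformalPolygon n}

/-- The 1-form on the hyperelliptic surface to which the Schwarz-Christoffel integrand
`∏ (t - t_i) ^ (a_i / 2) dt` lifts, as a coefficient of `dt`. Since all `a_i` are odd and
`y = ∏ (t - t_i) ^ (1 / 2)`, the integrand is `y ∏ (t - t_i) ^ ((a_i - 1) / 2)`, where the
exponents are integers. -/
noncomputable def form (A : Orthodisk P) (p : P.AffineCurve) : ℂ :=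
  p.1.2 * ∏ i, (p.1.1 - (P.t i : ℂ)) ^ ((A.data (some i) - 1) / 2)

/-- The lifted form is indeed a square root of `∏ (t - t_i) ^ a_i`. -/
theorem form_sq (A : Orthodisk P) (p : P.AffineCurve) (hp : p.1.2 ≠ 0) :
    A.form p ^ 2 = ∏ i, (p.1.1 - (P.t i : ℂ)) ^ A.data (some i) := by
  have hne : ∀ i, p.1.1 - (P.t i : ℂ) ≠ 0 := by
    have h : ∏ i, (p.1.1 - (P.t i : ℂ)) ≠ 0 := by
      rw [← p.2]; exact pow_ne_zero 2 hp
    exact fun i => Finset.prod_ne_zero_iff.mp h i (Finset.mem_univ i)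
  unfold form
  rw [mul_pow, p.2, ← Finset.prod_pow, ← Finset.prod_mul_distrib]
  refine Finset.prod_congr rfl fun i _ => ?_
  obtain ⟨k, hk⟩ := A.odd_data (some i)
  have h2 : (A.data (some i) - 1) / 2 = k := by omega
  rw [h2, hk, zpow_add₀ (hne i), mul_comm 2 k, zpow_mul, zpow_one, mul_comm]
  norm_cast

/-- A vertex at which one of the two orthodisks is infinite (angle `≤ 0`): such a vertex is
an end of the surface defined by the pair. The other vertices are ordinary points of it. -/
def IsEnd (A B : Orthodisk P) (v : Option (Fin n)) : Prop :=
  A.data v ≤ -2 ∨ B.data v ≤ -2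

/-- The vertex data of a catenoid end. -/
def IsCatenoidVertex (A B : Orthodisk P) (v : Option (Fin n)) : Prop :=
  (A.data v = -3 ∧ B.data v = -1) ∨ (A.data v = -1 ∧ B.data v = -3)

/-- The vertex data of a planar end. -/
def IsPlanarVertex (A B : Orthodisk P) (v : Option (Fin n)) : Prop :=
  (A.data v = -3 ∧ B.data v = 3) ∨ (A.data v = 3 ∧ B.data v = -3)

end Orthodisk

/-- A minimal surface in `ℝ³` given by the pair of orthodisks `A` and `B` on the same conformal
polygon. There are a Gauss map `G` and a height differential `dh` on the hyperelliptic surface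
(`dh` is given by its coefficient with respect to `dt`) such that `G dh` and `G⁻¹ dh` are,
up to homothety, the forms of the two orthodisks. Their period problem is solved: there is a well
defined map `X` into `ℝ³` with
`dX = Re (½ (G - G⁻¹) dh, (i / 2) (G + G⁻¹) dh, dh)`, defined on the compact surface minus the ends
(its values at the ends are irrelevant). It is continuous, hence smooth, at the points over
those vertices that are not ends. By the two product equations `G` and `dh` have at most poles at the
points over the vertices, so they are meromorphic on the compact surface. -/
structure OrthodiskSurface {n : ℕ} {P : ConformalPolygon n} (A B : Orthodisk P) where
  G : P.AffineCurve → ℂ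
  dh : P.AffineCurve → ℂ
  holomorphic_G : P.HolomorphicOffVertices G
  holomorphic_dh : P.HolomorphicOffVertices dh
  c₁ : ℂ
  c₂ : ℂ
  c₁_ne_zero : c₁ ≠ 0
  c₂_ne_zero : c₂ ≠ 0
  G_mul_dh : ∀ p : P.AffineCurve, p.1.2 ≠ 0 → G p * dh p = c₁ * A.form p
  inv_G_mul_dh : ∀ p : P.AffineCurve, p.1.2 ≠ 0 → (G p)⁻¹ * dh p = c₂ * B.form p
  X : P.Curve → EuclideanSpace ℝ (Fin 3)
  hasFDerivAt_X : ∀ (t₀ : ℂ) (s : ℂ → P.AffineCurve), P.IsLocalSection s t₀ → ∀ k : Fin 3,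
    HasFDerivAt (fun t : ℂ => X (s t : OnePoint P.AffineCurve) k)
      (Complex.reCLM.comp (((![(G (s t₀) - (G (s t₀))⁻¹) * dh (s t₀) / 2,
          Complex.I * (G (s t₀) + (G (s t₀))⁻¹) * dh (s t₀) / 2,
          dh (s t₀)] k) • (ContinuousLinearMap.id ℂ ℂ)).restrictScalars ℝ)) t₀
  continuousAt_X : ∀ v, ¬ Orthodisk.IsEnd A B v → ContinuousAt X (P.vertexPoint v)

/-- The component of `x` orthogonal to the unit vector `ν`. -/
noncomputable def horizontalPart (ν x : EuclideanSpace ℝ (Fin 3)) : EuclideanSpace ℝ (Fin 3) :=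
  x - inner ℝ x ν • ν

/-- The end of `X` at the puncture `p` is an embedded end with asymptotic plane orthogonal to the
unit vector `ν`, logarithmic growth rate `α` and height `β`: a punctured neighbourhood of `p` is
mapped onto the graph, over the exterior of a disc in the plane `ν^⊥`, of a function
`u (x) = α log ‖x‖ + β + o(1)`. For `α = 0` the end is asymptotic to a plane at height `β`. For
`α ≠ 0` it is asymptotic to a half catenoid with axis parallel to `ν`, opening in the direction
`ν` if `α > 0` and in the direction `-ν` if `α < 0`. -/
def IsEmbeddedEnd {Z : Type*} [TopologicalSpace Z] (X : Z → EuclideanSpace ℝ (Fin 3)) (p : Z)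
    (ν : EuclideanSpace ℝ (Fin 3)) (α β : ℝ) : Prop :=
  Tendsto (fun z => ‖horizontalPart ν (X z)‖) (𝓝[≠] p) atTop ∧
  (∃ R > 0, ∃ U ∈ 𝓝 p, Set.BijOn (fun z => horizontalPart ν (X z)) (U \ {p})
    {x | inner ℝ x ν = 0 ∧ R < ‖x‖}) ∧
  Tendsto (fun z => inner ℝ (X z) ν - α * Real.log ‖horizontalPart ν (X z)‖) (𝓝[≠] p) (𝓝 β)

namespace OrthodiskSurface

variable {n : ℕ} {P : ConformalPolygon n} {A B : Orthodisk P}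

/-- The ends of the surface, one at each infinite vertex, are planar or catenoidal, they are all
parallel (with a common unit normal `ν`), different planar ends have different heights, and
different catenoid ends opening in the same direction have different growth rates (the end
with the larger growth rate is then the higher one, far out). A catenoid end opening up is above,
and one opening down is below, all planar ends. -/
def EventuallyEmbedded (S : OrthodiskSurface A B) : Prop :=
  ∃ ν : EuclideanSpace ℝ (Fin 3), ‖ν‖ = 1 ∧ ∃ growth height : Option (Fin n) → ℝ,
    (∀ v, Orthodisk.IsEnd A B v →
      IsEmbeddedEnd S.X (P.vertexPoint v) ν (growth v) (height v)) ∧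
    (∀ v w, Orthodisk.IsEnd A B v → Orthodisk.IsEnd A B w → v ≠ w →
      growth v = 0 → growth w = 0 → height v ≠ height w) ∧
    (∀ v w, Orthodisk.IsEnd A B v → Orthodisk.IsEnd A B w → v ≠ w →
      (0 < growth v ∧ 0 < growth w) ∨ (growth v < 0 ∧ growth w < 0) → growth v ≠ growth w)

/-- The end at `v` is a catenoid end opening in the direction of the unit vector `ν`. -/
def IsCatenoidEndToward (S : OrthodiskSurface A B) (v : Option (Fin n))
    (ν : EuclideanSpace ℝ (Fin 3)) : Prop :=
  ‖ν‖ = 1 ∧ ∃ α β : ℝ, 0 < α ∧ IsEmbeddedEnd S.X (P.vertexPoint v) ν α β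

end OrthodiskSurface

/-! Over the vertex `t_i` the hyperelliptic curve has the parameter `w` with `t = t_i + w²`, over
`∞` the one with `t = w⁻²`. There the two forms are `w ^ (a + 1)` and `w ^ (b + 1)` times
nonvanishing analytic functions of `w²`, and `dh`, a square root of their product up to a constant,
is `w ^ ((a + b) / 2 + 1)` times another such function.

Parity: replacing `w` by `-w` shows that the hyperelliptic involution multiplies `dh` by `(-1) ^ ((a
+ b) / 2)` near each vertex. The upper half-plane is connected, so this sign is the same at all
vertices (`neg_one_zpow_eq`). At a catenoid vertex `a + b = -4`; hence `4 ∣ a + b` everywhere, and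
with completeness only catenoid vertices, planar vertices and ordinary points of type `{-1, 1}` are
left.

Ends: at a catenoid or planar vertex one form has a double pole without residue and the other is
holomorphic, so the horizontal coordinate is a conjugate simple pole plus a `C¹` term, up to
conjugation, and the end is a graph over an exterior domain (`isPoleLike_of_weierstrass`). Since
`dh` has at most a simple pole, the height is logarithmic there. All the limit normals are vertical.

Global height: the product of the two forms is now the square of a rational function of `t`. Over
the upper half-plane `dh` is therefore a constant times the form with simple poles exactly at the
two catenoid vertices, and the height is `Re (k * dipole) + κ`. At the catenoid end over a finite
vertex the height has no angular term, which forces `k` to be real (`im_eq_zero_of_tendsto_dipole`).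
The growth rates are then `-2k` and `2k`: opposite and nonzero. A planar end has height `k * log |f|
+ κ`, where `f` is a Möbius function with zero and pole at the catenoid vertices. On one component
of the circle without these two points `f` is injective and of constant sign, so different planar
ends have different heights (`eq_of_dipoleValue_eq`). -/

open ComplexConjugate

/-! ### Functions on a punctured disc: primitives, square roots, logarithmic terms -/

/-- The real-linear form `z ↦ Re (a z)`. -/
noncomputable def reMul (a : ℂ) : ℂ →L[ℝ] ℝ :=
  Complex.reCLM.comp ((a • ContinuousLinearMap.id ℂ ℂ).restrictScalars ℝ)

@[simp] theorem reMul_apply (a z : ℂ) : reMul a z = (a * z).re := by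
  simp [reMul]

theorem HasDerivAt.hasFDerivAt_re {f : ℂ → ℂ} {a w : ℂ} (h : HasDerivAt f a w) :
    HasFDerivAt (fun z => (f z).re) (reMul a) w := by
  have h1 := Complex.reCLM.hasFDerivAt.comp w (h.hasFDerivAt.restrictScalars ℝ)
  refine h1.congr_fderiv ?_
  ext z
  simp [mul_comm]

theorem exists_radius_of_eventually {p : ℂ → Prop} (h : ∀ᶠ w in 𝓝[≠] (0 : ℂ), p w) :
    ∃ r > 0, ∀ w : ℂ, w ≠ 0 → ‖w‖ < r → p w := by
  rw [eventually_nhdsWithin_iff, Metric.eventually_nhds_iff] at h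
  obtain ⟨r, hr, h⟩ := h
  exact ⟨r, hr, fun w hw hwr => h (by simpa using hwr) hw⟩

theorem eventually_of_radius {p : ℂ → Prop} {r : ℝ} (hr : 0 < r)
    (h : ∀ w : ℂ, w ≠ 0 → ‖w‖ < r → p w) : ∀ᶠ w in 𝓝[≠] (0 : ℂ), p w := by
  rw [eventually_nhdsWithin_iff, Metric.eventually_nhds_iff]
  exact ⟨r, hr, fun w hwr hw => h w hw (by simpa using hwr)⟩

/-- The punctured disc is the image under `exp` of a left half-plane, which is convex. -/
theorem isPreconnected_puncturedBall (r : ℝ) : IsPreconnected {w : ℂ | w ≠ 0 ∧ ‖w‖ < r} := by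
  rcases le_or_gt r 0 with hr | hr
  · have : {w : ℂ | w ≠ 0 ∧ ‖w‖ < r} = ∅ := by
      ext w
      simp only [Set.mem_ofPred_eq, Set.mem_empty_iff_false, iff_false, not_and, not_lt]
      exact fun _ => hr.trans (norm_nonneg w)
    rw [this]; exact isPreconnected_empty
  · have h : {w : ℂ | w ≠ 0 ∧ ‖w‖ < r} = Complex.exp '' {z : ℂ | z.re < Real.log r} := by
      ext w
      constructor
      · rintro ⟨hw, hwr⟩
        refine ⟨Complex.log w, ?_, Complex.exp_log hw⟩
        simpa [Complex.log_re] using Real.log_lt_log (norm_pos_iff.mpr hw) hwr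
      · rintro ⟨z, hz, rfl⟩
        refine ⟨Complex.exp_ne_zero z, ?_⟩
        rw [Complex.norm_exp]
        exact (Real.lt_log_iff_exp_lt hr).mp hz
    rw [h]
    exact (convex_halfSpace_re_lt _).isPreconnected.image _ Complex.continuous_exp.continuousOn

theorem isOpen_puncturedBall (r : ℝ) : IsOpen {w : ℂ | w ≠ 0 ∧ ‖w‖ < r} :=
  isOpen_ne.inter (isOpen_lt continuous_norm continuous_const)

theorem exists_eventually_eq_const {f : ℂ → ℝ}
    (h : ∀ᶠ w in 𝓝[≠] (0 : ℂ), HasFDerivAt f (0 : ℂ →L[ℝ] ℝ) w) :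
    ∃ c, ∀ᶠ w in 𝓝[≠] (0 : ℂ), f w = c := by
  obtain ⟨r, hr, h⟩ := exists_radius_of_eventually h
  obtain ⟨c, hc⟩ := (isOpen_puncturedBall r).exists_is_const_of_fderiv_eq_zero (𝕜 := ℝ) (f := f)
    (isPreconnected_puncturedBall r)
    (fun w hw => (h w hw.1 hw.2).differentiableAt.differentiableWithinAt)
    (fun w hw => (h w hw.1 hw.2).fderiv)
  exact ⟨c, eventually_of_radius hr fun w h1 h2 => hc w ⟨h1, h2⟩⟩

theorem exists_eventually_eq_re_add {x : ℂ → ℝ} {h Ξ : ℂ → ℂ}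
    (hx : ∀ᶠ w in 𝓝[≠] (0 : ℂ), HasFDerivAt x (reMul (h w)) w)
    (hΞ : ∀ᶠ w in 𝓝[≠] (0 : ℂ), HasDerivAt Ξ (h w) w) :
    ∃ c : ℝ, ∀ᶠ w in 𝓝[≠] (0 : ℂ), x w = (Ξ w).re + c := by
  obtain ⟨c, hc⟩ := exists_eventually_eq_const (f := fun w => x w - (Ξ w).re) (by
    filter_upwards [hx, hΞ] with w h1 h2
    exact (h1.sub h2.hasFDerivAt_re).congr_fderiv (sub_self _))
  exact ⟨c, hc.mono fun w hw => by linarith⟩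

theorem AnalyticAt.exists_primitive {k : ℂ → ℂ} (hk : AnalyticAt ℂ k 0) :
    ∃ K : ℂ → ℂ, AnalyticAt ℂ K 0 ∧ ∀ᶠ w in 𝓝 (0 : ℂ), HasDerivAt K (k w) w := by
  obtain ⟨r, hr, h⟩ := Metric.eventually_nhds_iff_ball.mp hk.eventually_analyticAt
  have hd : DifferentiableOn ℂ k (Metric.ball 0 r) :=
    fun w hw => (h w hw).differentiableAt.differentiableWithinAt
  obtain ⟨K, hK⟩ := hd.isExactOn_ball
  have hev : ∀ᶠ w in 𝓝 (0 : ℂ), HasDerivAt K (k w) w :=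
    Metric.eventually_nhds_iff_ball.mpr ⟨r, hr, fun w hw => hK w hw⟩
  refine ⟨K, ?_, hev⟩
  rw [Complex.analyticAt_iff_eventually_differentiableAt]
  exact hev.mono fun w hw => hw.differentiableAt

theorem AnalyticAt.exists_eq_add_mul {f : ℂ → ℂ} (hf : AnalyticAt ℂ f 0) :
    ∃ k : ℂ → ℂ, AnalyticAt ℂ k 0 ∧ ∀ w, f w = f 0 + w * k w := by
  refine ⟨dslope f 0, ?_, fun w => ?_⟩
  · obtain ⟨p, hp⟩ := hf
    exact ⟨_, hp.has_fpower_series_dslope_fslope⟩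
  · have := sub_smul_dslope f 0 w
    simp only [sub_zero, smul_eq_mul] at this
    rw [this]; ring

/-- An analytic square root of an analytic function at a point where it does not vanish. -/
theorem AnalyticAt.exists_sq_eq {f : ℂ → ℂ} (hf : AnalyticAt ℂ f 0) (h0 : f 0 ≠ 0) :
    ∃ e : ℂ → ℂ, AnalyticAt ℂ e 0 ∧ e 0 ≠ 0 ∧ ∀ u, e u ^ 2 = f u := by
  -- Splitting off `f 0` leaves a quotient with value `1` at `0`, away from the cut of the principal
  -- root.
  have hsq : ∀ u, ((f 0) ^ (((2 : ℕ) : ℂ)⁻¹) * (f u / f 0) ^ (((2 : ℕ) : ℂ)⁻¹)) ^ 2 = f u := by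
    intro u
    rw [mul_pow, Complex.cpow_nat_inv_pow _ two_ne_zero, Complex.cpow_nat_inv_pow _ two_ne_zero]
    field_simp
  refine ⟨fun u => (f 0) ^ (((2 : ℕ) : ℂ)⁻¹) * (f u / f 0) ^ (((2 : ℕ) : ℂ)⁻¹), ?_, ?_, hsq⟩
  · refine analyticAt_const.mul ((hf.div analyticAt_const h0).cpow analyticAt_const ?_)
    simp [h0]
  · intro h
    have := hsq 0
    simp only at h
    rw [h] at this
    exact h0 (by rw [← this]; norm_num)

theorem hasFDerivAt_log_norm {w : ℂ} (hw : w ≠ 0) :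
    HasFDerivAt (fun z : ℂ => Real.log ‖z‖) (reMul w⁻¹) w := by
  -- Dividing by `w` puts the argument at `1`, so the branch cut does not matter.
  have h1 : HasDerivAt (fun z : ℂ => Complex.log (z / w)) w⁻¹ w := by
    have := ((hasDerivAt_id w).div_const w).clog (by simp [hw])
    simpa [hw] using this
  have h2 := h1.hasFDerivAt_re.add_const (Real.log ‖w‖)
  refine h2.congr_of_eventuallyEq ?_
  filter_upwards [isOpen_ne.mem_nhds hw] with z hz
  simp only [Complex.log_re, norm_div]
  rw [Real.log_div (norm_ne_zero_iff.mpr hz) (norm_ne_zero_iff.mpr hw)]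
  ring

/-- A real function on a punctured disc with differential `Re (g w / w dw)`, where `g` is analytic:
the residue `g 0` is real, and the function is `g 0 * log ‖w‖` up to a convergent term. -/
theorem tendsto_sub_log_of_simple_pole {u : ℂ → ℝ} {g : ℂ → ℂ} (hg : AnalyticAt ℂ g 0)
    (hu : ∀ᶠ w in 𝓝[≠] (0 : ℂ), HasFDerivAt u (reMul (w⁻¹ * g w)) w) :
    ∃ β : ℝ, Tendsto (fun w => u w - (g 0).re * Real.log ‖w‖) (𝓝[≠] 0) (𝓝 β) := by
  obtain ⟨k, hk, hgk⟩ := hg.exists_eq_add_mul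
  obtain ⟨K, hKa, hK⟩ := hk.exists_primitive
  have hv : ∀ᶠ w in 𝓝[≠] (0 : ℂ),
      HasFDerivAt (fun z => u z - (K z).re) (reMul (g 0 * w⁻¹)) w := by
    filter_upwards [hu, hK.filter_mono nhdsWithin_le_nhds, self_mem_nhdsWithin] with w h1 h2 hw
    refine (h1.sub h2.hasFDerivAt_re).congr_fderiv ?_
    have hw' : w ≠ 0 := hw
    have : w⁻¹ * g w = g 0 * w⁻¹ + k w := by rw [hgk w]; field_simp
    ext z; simp [this, add_mul]
  -- Along a small circle `u - Re K` changes at the constant rate `-Im (g 0)`, and it must return to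
  -- its initial value.
  have him : (g 0).im = 0 := by
    obtain ⟨r, hr, h⟩ := exists_radius_of_eventually hv
    set ρ : ℝ := r / 2 with hρ
    have hρ0 : 0 < ρ := by positivity
    let γ : ℝ → ℂ := fun θ => ρ * Complex.exp (θ * Complex.I)
    have hγ0 : ∀ θ, γ θ ≠ 0 := fun θ =>
      mul_ne_zero (by exact_mod_cast hρ0.ne') (Complex.exp_ne_zero _)
    have hγn : ∀ θ, ‖γ θ‖ < r := fun θ => by
      simp only [γ, norm_mul, Complex.norm_exp_ofReal_mul_I, Complex.norm_real, Real.norm_eq_abs,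
        abs_of_pos hρ0]
      rw [hρ]; linarith
    have hγd : ∀ θ : ℝ, HasDerivAt γ (γ θ * Complex.I) θ := fun θ => by
      have h1 : HasDerivAt (fun θ : ℝ => (θ : ℂ) * Complex.I) (1 * Complex.I) θ :=
        (Complex.ofRealCLM.hasDerivAt (x := θ)).mul_const Complex.I
      have h2 := (h1.cexp).const_mul (ρ : ℂ)
      simpa [γ, mul_assoc] using h2
    have hd : ∀ θ : ℝ, HasDerivAt (fun θ => u (γ θ) - (K (γ θ)).re + θ * (g 0).im) 0 θ := by
      intro θ
      have h1 := (h (γ θ) (hγ0 θ) (hγn θ)).comp_hasDerivAt θ (hγd θ)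
      have h2 := h1.add ((hasDerivAt_id θ).mul_const (g 0).im)
      refine h2.congr_deriv ?_
      rw [reMul_apply]
      have := hγ0 θ
      rw [show g 0 * (γ θ)⁻¹ * (γ θ * Complex.I) = g 0 * Complex.I by field_simp]
      simp
    have hc := is_const_of_deriv_eq_zero (fun θ => (hd θ).differentiableAt)
      (fun θ => (hd θ).deriv) 0 (2 * Real.pi)
    have hper : γ (2 * Real.pi) = γ 0 := by
      simp [γ, Complex.exp_two_pi_mul_I]
    rw [hper] at hc
    have : 2 * Real.pi * (g 0).im = 0 := by linarith
    rcases mul_eq_zero.mp this with h | h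
    · exact absurd h (by positivity)
    · exact h
  obtain ⟨c, hc⟩ := exists_eventually_eq_const
      (f := fun w => u w - (K w).re - (g 0).re * Real.log ‖w‖) (by
    filter_upwards [hv, self_mem_nhdsWithin] with w h1 hw
    refine (h1.sub ((hasFDerivAt_log_norm hw).const_mul (g 0).re)).congr_fderiv ?_
    have hg0 : g 0 = ((g 0).re : ℂ) := Complex.ext rfl (by simp [him])
    rw [hg0]
    ext z
    simp
    ring)
  refine ⟨(K 0).re + c, ?_⟩
  have h1 : Tendsto (fun w => (K w).re + c) (𝓝[≠] 0) (𝓝 ((K 0).re + c)) :=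
    ((Complex.continuous_re.tendsto _).comp
      (hKa.continuousAt.tendsto.mono_left nhdsWithin_le_nhds)).add_const c
  refine h1.congr' ?_
  filter_upwards [hc] with w hw
  linarith

/-! ### The horizontal projection of an end -/

/-- `H` behaves near the puncture `0` like a (holomorphic or antiholomorphic) simple pole: it maps
arbitrarily small punctured neighbourhoods bijectively onto exteriors of discs, and `‖H w‖` is
asymptotic to a multiple of `1 / ‖w‖`. -/
def IsPoleLike (H : ℂ → ℂ) : Prop :=
  (∀ W ∈ 𝓝 (0 : ℂ), ∃ R > 0, ∃ V ∈ 𝓝 (0 : ℂ), V ⊆ W ∧ Set.BijOn H (V \ {0}) {z | R < ‖z‖}) ∧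
  Tendsto (fun w => ‖H w‖) (𝓝[≠] 0) atTop ∧
  ∃ γ : ℝ, Tendsto (fun w => Real.log ‖H w‖ + Real.log ‖w‖) (𝓝[≠] 0) (𝓝 γ)

theorem bijOn_inv_conj {R : ℝ} (hR : 0 < R) :
    Set.BijOn (fun z : ℂ => (conj z)⁻¹) (Metric.ball 0 R⁻¹ \ {0}) {z | R < ‖z‖} := by
  refine ⟨?_, ?_, ?_⟩
  · rintro z ⟨hz, hz0⟩
    have h0 : 0 < ‖z‖ := norm_pos_iff.mpr hz0
    simp only [Metric.mem_ball, dist_zero_right] at hz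
    simp only [Set.mem_ofPred_eq, norm_inv, Complex.norm_conj]
    rwa [lt_inv_comm₀ hR h0]
  · intro z _ w _ h
    exact (starRingEnd ℂ).injective (inv_injective h)
  · intro z hz
    have hz' : R < ‖z‖ := hz
    have h0 : 0 < ‖z‖ := hR.trans hz'
    refine ⟨(conj z)⁻¹, ⟨?_, ?_⟩, by simp⟩
    · simp only [Metric.mem_ball, dist_zero_right, norm_inv, Complex.norm_conj]
      exact (inv_lt_inv₀ h0 hR).mpr hz'
    · simpa using norm_pos_iff.mp h0

/-- With `D = conj C + w * conj S` one has `H = 1 / conj (w / D)`. The map `w / D` is `C¹` with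
invertible derivative `1 / conj C` at `0`, so the inverse function theorem maps suitable small
neighbourhoods onto discs, and the conjugate inversion turns punctured discs into exteriors. -/
theorem isPoleLike_of_conj_pole {H S : ℂ → ℂ} {C : ℂ} (hC : C ≠ 0) (hS : ContDiffAt ℝ 1 S 0)
    (hH : ∀ᶠ w in 𝓝[≠] (0 : ℂ), H w = C / conj w + S w) : IsPoleLike H := by
  have hC' : conj C ≠ 0 := by simpa using hC
  set D : ℂ → ℂ := fun w => conj C + w * conj (S w) with hD
  have hDc : ContDiffAt ℝ 1 D 0 := by
    refine contDiffAt_const.add (contDiffAt_id.mul ?_)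
    exact Complex.conjCLE.contDiff.contDiffAt.comp (0 : ℂ) hS
  have hD0 : D 0 = conj C := by simp [hD]
  have hDne : ∀ᶠ w in 𝓝 (0 : ℂ), D w ≠ 0 :=
    hDc.continuousAt.eventually_ne (by rw [hD0]; exact hC')
  have hHD : ∀ᶠ w in 𝓝[≠] (0 : ℂ), w ≠ 0 ∧ D w ≠ 0 ∧ H w = conj (D w) / conj w := by
    filter_upwards [hH, self_mem_nhdsWithin, hDne.filter_mono nhdsWithin_le_nhds] with w h hw h2
    have hw' : conj w ≠ 0 := by simpa using hw
    refine ⟨hw, h2, ?_⟩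
    rw [h, hD]
    simp only [map_add, map_mul, Complex.conj_conj]
    field_simp
  have hnorm : ∀ᶠ w in 𝓝[≠] (0 : ℂ), ‖H w‖ = ‖D w‖ / ‖w‖ := by
    filter_upwards [hHD] with w h
    rw [h.2.2]; simp
  have hDlim : Tendsto (fun w => ‖D w‖) (𝓝[≠] 0) (𝓝 ‖C‖) := by
    have := hDc.continuousAt.norm.tendsto.mono_left (nhdsWithin_le_nhds (s := {0}ᶜ))
    rwa [hD0, Complex.norm_conj] at this
  refine ⟨?_, ?_, Real.log ‖C‖, ?_⟩
  · intro W hW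
    have hstrict : HasStrictFDerivAt (fun w => w * (D w)⁻¹)
        ((ContinuousLinearEquiv.unitsEquivAut ℂ (Units.mk0 _ (inv_ne_zero hC'))).restrictScalars ℝ :
          ℂ →L[ℝ] ℂ) 0 := by
      have h1 : HasStrictFDerivAt (fun w => (D w)⁻¹) (fderiv ℝ (fun w => (D w)⁻¹) 0) 0 :=
        (hDc.inv (by rw [hD0]; exact hC')).hasStrictFDerivAt one_ne_zero
      have h2 := (hasStrictFDerivAt_id (𝕜 := ℝ) (0 : ℂ)).mul h1
      refine h2.congr_fderiv ?_
      ext z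
      simp [hD0, mul_comm]
    set K : ℂ → ℂ := fun w => w * (D w)⁻¹ with hK
    let e := hstrict.toOpenPartialHomeomorph K
    have he : ∀ w, e w = K w := fun w => by
      rw [hstrict.toOpenPartialHomeomorph_coe]
    have hmem : (0 : ℂ) ∈ e.source := hstrict.mem_toOpenPartialHomeomorph_source
    have hK0 : K 0 = 0 := by simp [hK]
    obtain ⟨r, hr, hgood⟩ := exists_radius_of_eventually hHD
    obtain ⟨W', hW'W, hW'o, h0W'⟩ := mem_nhds_iff.mp (inter_mem hW (Metric.ball_mem_nhds 0 hr))
    have hopen : IsOpen (e '' (e.source ∩ W')) :=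
      e.isOpen_image_of_subset_source (e.open_source.inter hW'o) Set.inter_subset_left
    have h0 : (0 : ℂ) ∈ e '' (e.source ∩ W') := ⟨0, ⟨hmem, h0W'⟩, by rw [he, hK0]⟩
    obtain ⟨δ, hδ, hball⟩ := Metric.isOpen_iff.mp hopen 0 h0
    -- Cutting down to the preimage of a disc makes the image exactly a disc, hence the exterior
    -- radius `δ⁻¹`.
    refine ⟨δ⁻¹, inv_pos.mpr hδ, (e.source ∩ W') ∩ K ⁻¹' Metric.ball 0 δ, ?_, ?_, ?_⟩
    · refine inter_mem ((e.open_source.inter hW'o).mem_nhds ⟨hmem, h0W'⟩) ?_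
      refine ContinuousAt.preimage_mem_nhds hstrict.continuousAt ?_
      rw [hK0]; exact Metric.ball_mem_nhds 0 hδ
    · exact fun w hw => (hW'W hw.1.2).1
    · have hKbij : Set.BijOn K (((e.source ∩ W') ∩ K ⁻¹' Metric.ball 0 δ) \ {0})
          (Metric.ball 0 (δ⁻¹)⁻¹ \ {0}) := by
        rw [inv_inv]
        have hinj : Set.InjOn K e.source := fun a ha b hb hab =>
          e.injOn ha hb (by rwa [he, he])
        refine ⟨?_, hinj.mono fun w hw => hw.1.1.1, ?_⟩
        · rintro w ⟨⟨⟨hw1, -⟩, hw2⟩, hw0⟩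
          refine ⟨hw2, fun h => hw0 ?_⟩
          exact hinj hw1 hmem (by rw [hK0]; exact h)
        · rintro z ⟨hz, hz0⟩
          obtain ⟨w, hw, hwz⟩ := hball hz
          rw [he] at hwz
          refine ⟨w, ⟨⟨hw, ?_⟩, ?_⟩, hwz⟩
          · rw [Set.mem_preimage, hwz]; exact hz
          · rintro rfl
            exact hz0 (by rw [← hwz]; exact hK0)
      refine ((bijOn_inv_conj (inv_pos.mpr hδ)).comp hKbij).congr ?_
      rintro w ⟨⟨⟨-, hw⟩, -⟩, hw0⟩
      obtain ⟨h1, h2, h3⟩ := hgood w hw0 (by simpa using (hW'W hw).2)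
      rw [h3]
      simp [hK, div_eq_mul_inv]
  · have h1 : Tendsto (fun w : ℂ => ‖w‖⁻¹) (𝓝[≠] 0) atTop :=
      tendsto_inv_nhdsGT_zero.comp tendsto_norm_nhdsNE_zero
    refine (hDlim.pos_mul_atTop (norm_pos_iff.mpr hC) h1).congr' ?_
    filter_upwards [hnorm] with w h
    rw [h, div_eq_mul_inv]
  · refine (hDlim.log (norm_ne_zero_iff.mpr hC)).congr' ?_
    filter_upwards [hnorm, hHD] with w h h2
    rw [h, Real.log_div (norm_ne_zero_iff.mpr h2.2.1) (norm_ne_zero_iff.mpr h2.1)]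
    ring

theorem IsPoleLike.of_conj {H : ℂ → ℂ} (h : IsPoleLike fun w => conj (H w)) : IsPoleLike H := by
  obtain ⟨h1, h2, γ, h3⟩ := h
  refine ⟨fun W hW => ?_, by simpa using h2, γ, by simpa using h3⟩
  obtain ⟨R, hR, V, hV, hVW, hb⟩ := h1 W hW
  refine ⟨R, hR, V, hV, hVW, ?_⟩
  have hc : Set.BijOn (fun z : ℂ => conj z) {z | R < ‖z‖} {z | R < ‖z‖} :=
    ⟨fun z hz => by simpa using hz, fun z _ w _ hzw => (starRingEnd ℂ).injective hzw,
      fun z hz => ⟨conj z, by simpa using hz, by simp⟩⟩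
  refine (hc.comp hb).congr fun w _ => ?_
  simp

/-- The horizontal part of a Weierstrass representation near an end: one of the two forms
has a double pole without residue, the other is holomorphic. -/
theorem isPoleLike_of_weierstrass {x y : ℂ → ℝ} {φ ψ f g : ℂ → ℂ}
    (hx : ∀ᶠ w in 𝓝[≠] (0 : ℂ), HasFDerivAt x (reMul ((φ w - ψ w) / 2)) w)
    (hy : ∀ᶠ w in 𝓝[≠] (0 : ℂ), HasFDerivAt y (reMul (Complex.I * (φ w + ψ w) / 2)) w)
    (hf : AnalyticAt ℂ f 0) (hf0 : f 0 ≠ 0) (hg : AnalyticAt ℂ g 0)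
    (h : (∀ᶠ w in 𝓝[≠] (0 : ℂ), φ w = (w ^ 2)⁻¹ * f (w ^ 2) ∧ ψ w = g w) ∨
      (∀ᶠ w in 𝓝[≠] (0 : ℂ), ψ w = (w ^ 2)⁻¹ * f (w ^ 2) ∧ φ w = g w)) :
    IsPoleLike fun w => (x w : ℂ) + y w * Complex.I := by
  obtain ⟨k, hk, hfk⟩ := hf.exists_eq_add_mul
  have hk2 : AnalyticAt ℂ (fun w => k (w ^ 2)) 0 :=
    AnalyticAt.comp_of_eq hk (analyticAt_id.pow 2) (by simp)
  obtain ⟨F, hFa, hF⟩ := hk2.exists_primitive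
  obtain ⟨Γ, hΓa, hΓ⟩ := hg.exists_primitive
  -- As `f` is evaluated at `w²`, its expansion `f 0 + w² k(w²)` gives a double pole with no `1 / w`
  -- term, so a single-valued primitive exists.
  have hpole : ∀ᶠ w in 𝓝[≠] (0 : ℂ),
      HasDerivAt (fun w => F w - f 0 / w) ((w ^ 2)⁻¹ * f (w ^ 2)) w := by
    filter_upwards [hF.filter_mono nhdsWithin_le_nhds, self_mem_nhdsWithin] with w h1 hw
    have hw' : w ≠ 0 := hw
    refine (h1.sub ((hasDerivAt_const w (f 0)).div (hasDerivAt_id w) hw')).congr_deriv ?_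
    rw [hfk (w ^ 2)]
    simp only [id]
    field_simp
    ring
  have hFc : ContDiffAt ℝ 1 F 0 := hFa.contDiffAt.restrict_scalars ℝ
  have hΓc : ContDiffAt ℝ 1 Γ 0 := hΓa.contDiffAt.restrict_scalars ℝ
  have hconj : ∀ {T : ℂ → ℂ}, ContDiffAt ℝ 1 T 0 → ContDiffAt ℝ 1 (fun w => conj (T w)) 0 :=
    fun hT => Complex.conjCLE.contDiff.contDiffAt.comp (0 : ℂ) hT
  have hΓ' := hΓ.filter_mono (nhdsWithin_le_nhds (s := {0}ᶜ))
  rcases h with h | h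
  · obtain ⟨c, hc⟩ := exists_eventually_eq_re_add (Ξ := fun w => (F w - f 0 / w - Γ w) / 2) hx (by
      filter_upwards [h, hpole, hΓ'] with w h1 h2 h3
      rw [h1.1, h1.2]
      exact (h2.sub h3).div_const 2)
    obtain ⟨d, hd⟩ := exists_eventually_eq_re_add
        (Ξ := fun w => Complex.I * (F w - f 0 / w + Γ w) / 2) hy (by
      filter_upwards [h, hpole, hΓ'] with w h1 h2 h3
      rw [h1.1, h1.2]
      exact ((h2.add h3).const_mul Complex.I).div_const 2)
    -- If `Φ` and `Γ` are primitives of `φ` and `ψ`, then `x + iy` is `(conj Φ - Γ) / 2` up to a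
    -- constant; the pole of `Φ` is conjugated.
    refine isPoleLike_of_conj_pole (C := -conj (f 0) / 2)
      (S := fun w => conj (F w) * (1 / 2) - Γ w * (1 / 2) + (c + d * Complex.I)) ?_ ?_ ?_
    · simpa using hf0
    · exact (((hconj hFc).mul contDiffAt_const).sub (hΓc.mul contDiffAt_const)).add contDiffAt_const
    · filter_upwards [hc, hd] with w h1 h2
      rw [h1, h2]
      have h3 : -conj (f 0) / 2 / conj w = -conj (f 0 / w) / 2 := by
        rw [map_div₀]; ring
      rw [h3]
      generalize f 0 / w = q
      apply Complex.ext <;> simp <;> ring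
  · obtain ⟨c, hc⟩ := exists_eventually_eq_re_add (Ξ := fun w => (Γ w - (F w - f 0 / w)) / 2) hx (by
      filter_upwards [h, hpole, hΓ'] with w h1 h2 h3
      rw [h1.1, h1.2]
      exact (h3.sub h2).div_const 2)
    obtain ⟨d, hd⟩ := exists_eventually_eq_re_add
        (Ξ := fun w => Complex.I * (Γ w + (F w - f 0 / w)) / 2) hy (by
      filter_upwards [h, hpole, hΓ'] with w h1 h2 h3
      rw [h1.1, h1.2]
      exact ((h3.add h2).const_mul Complex.I).div_const 2)
    -- Now the pole sits in the unconjugated term of `x + iy`, so the previous case applies to the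
    -- conjugate.
    refine IsPoleLike.of_conj (isPoleLike_of_conj_pole (C := conj (f 0) / 2)
      (S := fun w => Γ w * (1 / 2) - conj (F w) * (1 / 2) + (c - d * Complex.I)) ?_ ?_ ?_)
    · simpa using hf0
    · exact ((hΓc.mul contDiffAt_const).sub ((hconj hFc).mul contDiffAt_const)).add contDiffAt_const
    · filter_upwards [hc, hd] with w h1 h2
      rw [h1, h2]
      have h3 : conj (f 0) / 2 / conj w = conj (f 0 / w) / 2 := by
        rw [map_div₀]; ring
      rw [h3]
      generalize f 0 / w = q
      simp only [map_add, map_mul, Complex.conj_ofReal, Complex.conj_I]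
      apply Complex.ext <;> simp <;> ring

/-! ### Uniformizing parameters of the hyperelliptic curve at the vertices -/

namespace ConformalPolygon

variable {n : ℕ}

/-- The ramification point of the affine curve over `t_i`. -/
noncomputable def affineVertex (P : ConformalPolygon n) (i : Fin n) : P.AffineCurve :=
  ⟨((P.t i : ℂ), 0), by
    rw [Finset.prod_eq_zero (Finset.mem_univ i) (sub_self _), zero_pow two_ne_zero]⟩

/-- The punctured neighbourhoods of the point over a vertex. -/
noncomputable def vertexFilter (P : ConformalPolygon n) : Option (Fin n) → Filter P.AffineCurve
  | none => comap (fun z => z.1.1) (Bornology.cobounded ℂ)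
  | some i => 𝓝[≠] P.affineVertex i

/-- The distance of `t` to a vertex, with `1 / ‖t‖` as the distance to `∞`. -/
noncomputable def size (P : ConformalPolygon n) : Option (Fin n) → ℂ → ℝ
  | none, t => ‖t‖⁻¹
  | some i, t => ‖t - P.t i‖

/-- The hyperelliptic involution. -/
noncomputable def swap (P : ConformalPolygon n) (z : P.AffineCurve) : P.AffineCurve :=
  ⟨(z.1.1, -z.1.2), by rw [neg_sq]; exact z.2⟩

theorem continuous_swap (P : ConformalPolygon n) : Continuous P.swap :=
  Continuous.subtype_mk (by fun_prop) _

theorem isClosed_affine (P : ConformalPolygon n) :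
    IsClosed {p : ℂ × ℂ | p.2 ^ 2 = ∏ i, (p.1 - (P.t i : ℂ))} :=
  isClosed_eq (by fun_prop) (by fun_prop)

theorem isCompact_fst_le (P : ConformalPolygon n) (R : ℝ) :
    IsCompact {z : P.AffineCurve | ‖z.1.1‖ ≤ R} := by
  set M : ℝ := ∏ i, (R + |P.t i|) with hM
  have hK : IsCompact ((↑) ⁻¹' (Metric.closedBall (0 : ℂ) R ×ˢ Metric.closedBall (0 : ℂ) (1 + M)) :
      Set P.AffineCurve) :=
    (P.isClosed_affine.isClosedEmbedding_subtypeVal).isCompact_preimage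
      ((isCompact_closedBall _ _).prod (isCompact_closedBall _ _))
  refine hK.of_isClosed_subset (isClosed_le (by fun_prop) continuous_const) ?_
  intro z hz
  have hz' : ‖z.1.1‖ ≤ R := hz
  have h1 : ‖z.1.2‖ ^ 2 ≤ M := by
    rw [← norm_pow, z.2, norm_prod]
    refine Finset.prod_le_prod (fun i _ => norm_nonneg _) fun i _ => ?_
    refine (norm_sub_le _ _).trans ?_
    simpa using hz'
  refine ⟨by simpa using hz', ?_⟩
  simp only [Metric.mem_closedBall, dist_zero_right]
  nlinarith [sq_nonneg (‖z.1.2‖ - 1)]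

/-- The projection to `t` is proper, since a bound on `t` bounds `y² = ∏ (t - t_i)`. The punctured
neighbourhoods of the added point are therefore described by `‖t‖ → ∞`. -/
theorem coclosedCompact_affine (P : ConformalPolygon n) :
    coclosedCompact P.AffineCurve = comap (fun z => z.1.1) (Bornology.cobounded ℂ) := by
  rw [coclosedCompact_eq_cocompact]
  refine le_antisymm ?_ ?_
  · rw [← tendsto_iff_comap, ← tendsto_norm_atTop_iff_cobounded, tendsto_atTop]
    intro R
    rw [Filter.Eventually, mem_cocompact]
    refine ⟨_, P.isCompact_fst_le R, fun z hz => ?_⟩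
    exact (not_le.mp (show ¬ ‖z.1.1‖ ≤ R from hz)).le
  · intro s hs
    obtain ⟨K, hK, hKs⟩ := mem_cocompact.mp hs
    have hb : Bornology.IsBounded ((fun z : P.AffineCurve => z.1.1) '' K) :=
      (hK.image (by fun_prop)).isBounded
    refine ⟨_, Bornology.isBounded_def.mp hb, fun z hz => hKs fun hzK => hz ⟨z, hzK, rfl⟩⟩

theorem map_vertexFilter (P : ConformalPolygon n) (v : Option (Fin n)) :
    map (fun z : P.AffineCurve => (z : OnePoint P.AffineCurve)) (P.vertexFilter v) =
      𝓝[≠] (P.vertexPoint v) := by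
  cases v with
  | none =>
    change _ = 𝓝[≠] (OnePoint.infty : OnePoint P.AffineCurve)
    rw [OnePoint.nhdsNE_infty_eq, coclosedCompact_affine]; rfl
  | some i =>
    change map _ (𝓝[≠] P.affineVertex i) = 𝓝[≠] ((P.affineVertex i : P.AffineCurve) : OnePoint P.AffineCurve)
    rw [OnePoint.nhdsWithin_coe]
    congr 2
    ext z
    simp

theorem sub_ne_zero_of_snd_ne_zero {P : ConformalPolygon n} {z : P.AffineCurve} (hz : z.1.2 ≠ 0)
    (i : Fin n) : z.1.1 - (P.t i : ℂ) ≠ 0 := by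
  have h : ∏ i, (z.1.1 - (P.t i : ℂ)) ≠ 0 := by rw [← z.2]; exact pow_ne_zero 2 hz
  exact Finset.prod_ne_zero_iff.mp h i (Finset.mem_univ i)

/-- A uniformizing parameter `w` of the hyperelliptic surface near the point over a vertex, odd
under the hyperelliptic involution: `toFun` maps `w` to the surface, with inverse `inv`, and
`deriv` is the derivative of `t` with respect to `w`. -/
structure VertexChart (P : ConformalPolygon n) (v : Option (Fin n)) where
  toFun : ℂ → P.AffineCurve
  inv : P.AffineCurve → ℂ
  deriv : ℂ → ℂ
  tendsto_toFun : Tendsto toFun (𝓝[≠] 0) (P.vertexFilter v)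
  tendsto_inv : Tendsto inv (P.vertexFilter v) (𝓝[≠] 0)
  toFun_inv : ∀ᶠ z in P.vertexFilter v, toFun (inv z) = z
  regular : ∀ᶠ w in 𝓝[≠] 0, (toFun w).1.2 ≠ 0 ∧ deriv w ≠ 0 ∧ ContinuousAt toFun w ∧
    HasStrictDerivAt (fun w => (toFun w).1.1) (deriv w) w
  toFun_neg : ∀ᶠ w in 𝓝[≠] 0, toFun (-w) = P.swap (toFun w) ∧ deriv (-w) = -deriv w
  size_eq : ∀ᶠ w in 𝓝[≠] 0, P.size v (toFun w).1.1 = ‖w‖ ^ 2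
  form_eq : ∀ A : Orthodisk P, ∃ e : ℂ → ℂ, AnalyticAt ℂ e 0 ∧ e 0 ≠ 0 ∧
    ∀ᶠ w in 𝓝[≠] 0, A.form (toFun w) * deriv w = w ^ (A.data v + 1) * e (w ^ 2)
  continuousAt_deriv : ∀ᶠ w in 𝓝[≠] 0, ContinuousAt deriv w

theorem tendsto_sq_nhdsNE : Tendsto (fun w : ℂ => w ^ 2) (𝓝[≠] 0) (𝓝[≠] 0) := by
  refine tendsto_nhdsWithin_iff.mpr ⟨?_, ?_⟩
  · have : Tendsto (fun w : ℂ => w ^ 2) (𝓝 0) (𝓝 (0 ^ 2)) := (continuous_pow 2).tendsto 0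
    rw [zero_pow two_ne_zero] at this
    exact this.mono_left nhdsWithin_le_nhds
  · filter_upwards [self_mem_nhdsWithin] with w hw
    exact pow_ne_zero 2 hw

/-- The chart is `t = t_i + w²`, `y = w e(w²)`, where `e²` is the product of the other factors, with
inverse `w = y / e(t - t_i)`. In the lifted form `y`, `dt` and the factor at `t_i` contribute `w`,
`w` and `w ^ (a_i - 1)`, which gives the exponent `a_i + 1`. -/
theorem nonempty_vertexChart_some (P : ConformalPolygon n) (i : Fin n) :
    Nonempty (VertexChart P (some i)) := by
  have hnode : ∀ j ∈ Finset.univ.erase i, (P.t i : ℂ) + 0 - P.t j ≠ 0 := by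
    intro j hj
    rw [add_zero, sub_ne_zero]
    exact_mod_cast P.strictMono_t.injective.ne (Finset.ne_of_mem_erase hj).symm
  have hfac : ∀ j, AnalyticAt ℂ (fun u : ℂ => (P.t i : ℂ) + u - P.t j) 0 := fun j =>
    (analyticAt_const.add analyticAt_id).sub analyticAt_const
  have hf : AnalyticAt ℂ (fun u : ℂ => ∏ j ∈ Finset.univ.erase i, ((P.t i : ℂ) + u - P.t j)) 0 :=
    Finset.analyticAt_fun_prod _ fun j _ => hfac j
  obtain ⟨e, he, he0, hesq⟩ := hf.exists_sq_eq (Finset.prod_ne_zero_iff.mpr hnode)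
  have hprod : ∀ u : ℂ, ∏ j, ((P.t i : ℂ) + u - P.t j) = u * e u ^ 2 := by
    intro u
    rw [hesq, ← Finset.mul_prod_erase _ _ (Finset.mem_univ i)]
    congr 1; ring
  have hene : ∀ᶠ u in 𝓝 (0 : ℂ), e u ≠ 0 := he.continuousAt.eventually_ne he0
  have hene2 : ∀ᶠ w in 𝓝[≠] (0 : ℂ), e (w ^ 2) ≠ 0 :=
    tendsto_sq_nhdsNE.eventually (hene.filter_mono nhdsWithin_le_nhds)
  have hecont : ∀ᶠ w in 𝓝[≠] (0 : ℂ), ContinuousAt e (w ^ 2) :=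
    tendsto_sq_nhdsNE.eventually
      ((he.eventually_analyticAt.mono fun _ h => h.continuousAt).filter_mono nhdsWithin_le_nhds)
  let χ : ℂ → P.AffineCurve := fun w => ⟨((P.t i : ℂ) + w ^ 2, w * e (w ^ 2)), by
    rw [hprod]; ring⟩
  have hχc : ∀ w, ContinuousAt e (w ^ 2) → ContinuousAt χ w := by
    intro w hw
    refine (Topology.IsInducing.continuousAt_iff (g := Subtype.val) ⟨rfl⟩).mpr ?_
    have h2 : ContinuousAt (fun w : ℂ => e (w ^ 2)) w :=
      ContinuousAt.comp (f := fun w : ℂ => w ^ 2) hw (continuous_pow 2).continuousAt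
    exact ContinuousAt.prodMk (by fun_prop) (continuousAt_id.mul h2)
  have hχ0 : χ 0 = P.affineVertex i := by
    apply Subtype.ext; simp [χ, affineVertex]
  have hu : Tendsto (fun z : P.AffineCurve => z.1.1 - (P.t i : ℂ)) (𝓝 (P.affineVertex i)) (𝓝 0) := by
    have : Continuous (fun z : P.AffineCurve => z.1.1 - (P.t i : ℂ)) := by fun_prop
    have h := this.tendsto (P.affineVertex i)
    simpa [affineVertex] using h
  have hz : ∀ z : P.AffineCurve, z.1.2 ^ 2 = (z.1.1 - P.t i) * e (z.1.1 - P.t i) ^ 2 := by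
    intro z
    rw [z.2, ← hprod]
    exact Finset.prod_congr rfl fun j _ => by ring
  refine ⟨⟨χ, fun z => z.1.2 / e (z.1.1 - P.t i), fun w => 2 * w, ?_, ?_, ?_, ?_, ?_, ?_, ?_, ?_⟩⟩
  · refine tendsto_nhdsWithin_iff.mpr ⟨?_, ?_⟩
    · rw [← hχ0]
      refine (hχc 0 ?_).tendsto.mono_left nhdsWithin_le_nhds
      rw [zero_pow two_ne_zero]; exact he.continuousAt
    · filter_upwards [self_mem_nhdsWithin] with w hw h
      have h1 := congrArg (fun z : P.AffineCurve => z.1.1) h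
      have hw' : w ≠ 0 := hw
      simp [χ, affineVertex] at h1
      exact hw' h1
  · refine tendsto_nhdsWithin_iff.mpr ⟨?_, ?_⟩
    · have h1 : Tendsto (fun z : P.AffineCurve => z.1.2) (𝓝 (P.affineVertex i)) (𝓝 0) := by
        have : Continuous (fun z : P.AffineCurve => z.1.2) := by fun_prop
        exact this.tendsto (P.affineVertex i)
      have h2 := h1.div (he.continuousAt.tendsto.comp hu) he0
      rw [zero_div] at h2
      exact h2.mono_left nhdsWithin_le_nhds
    · filter_upwards [(hu.eventually hene).filter_mono nhdsWithin_le_nhds, self_mem_nhdsWithin]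
        with z h1 h2 h3
      rcases div_eq_zero_iff.mp h3 with h | h
      · have h4 := hz z
        rw [h, zero_pow two_ne_zero] at h4
        rcases mul_eq_zero.mp h4.symm with h5 | h5
        · exact h2 (Subtype.ext (Prod.ext (sub_eq_zero.mp h5) h))
        · exact pow_ne_zero 2 h1 h5
      · exact h1 h
  · filter_upwards [(hu.eventually hene).filter_mono nhdsWithin_le_nhds] with z h1
    have h2 : (z.1.2 / e (z.1.1 - P.t i)) ^ 2 = z.1.1 - P.t i := by
      rw [div_pow, hz z]; field_simp
    apply Subtype.ext
    apply Prod.ext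
    · simp only [χ, h2]; ring
    · simp only [χ, h2]; field_simp
  · filter_upwards [self_mem_nhdsWithin, hene2, hecont] with w hw h1 h2
    have hw' : w ≠ 0 := hw
    refine ⟨mul_ne_zero hw' h1, mul_ne_zero two_ne_zero hw', hχc w h2, ?_⟩
    have := ((hasStrictDerivAt_pow 2 w).const_add (P.t i : ℂ))
    simpa [χ] using this
  · refine Eventually.of_forall fun w => ⟨Subtype.ext (Prod.ext ?_ ?_), by ring⟩
    · simp [χ, swap]
    · simp [χ, swap]
  · refine Eventually.of_forall fun w => ?_
    simp [χ, size]
  · intro A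
    refine ⟨fun u => 2 * e u * ∏ j ∈ Finset.univ.erase i,
      ((P.t i : ℂ) + u - P.t j) ^ ((A.data (some j) - 1) / 2), ?_, ?_, ?_⟩
    · exact (analyticAt_const.mul he).mul
        (Finset.analyticAt_fun_prod _ fun j hj => (hfac j).fun_zpow (hnode j hj))
    · exact mul_ne_zero (mul_ne_zero two_ne_zero he0)
        (Finset.prod_ne_zero_iff.mpr fun j hj => zpow_ne_zero _ (hnode j hj))
    · filter_upwards [self_mem_nhdsWithin] with w hw
      have hw' : w ≠ 0 := hw
      obtain ⟨k, hk⟩ := A.odd_data (some i)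
      have h2 : (A.data (some i) - 1) / 2 = k := by omega
      simp only [Orthodisk.form, χ]
      rw [← Finset.mul_prod_erase _ _ (Finset.mem_univ i), h2, hk, add_sub_cancel_left,
        show 2 * k + 1 + 1 = 1 + 1 + 2 * k by ring, zpow_add₀ hw', zpow_add₀ hw', zpow_mul, zpow_one]
      norm_cast
      ring
  · exact Eventually.of_forall fun w => by fun_prop

/-- The chart is `t = w⁻²`, `y = w⁻ⁿ e(w²)`, with inverse `w = t ^ m e(1 / t) / y` for `n = 2m + 1`.
Because `n` is odd, `w` and `-w` lie on different sheets, so a single point lies over `∞`. -/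
theorem nonempty_vertexChart_none (P : ConformalPolygon n) (hn : Odd n) :
    Nonempty (VertexChart P none) := by
  obtain ⟨m, hm⟩ := hn
  have hpow : ∀ x : ℂ, x ^ n = (x ^ 2) ^ m * x := fun x => by rw [hm, pow_succ, pow_mul]
  have hpow' : ∀ x : ℂ, x ^ n = (x ^ m) ^ 2 * x := fun x => by rw [hpow, pow_right_comm]
  have hfac : ∀ j, AnalyticAt ℂ (fun u : ℂ => 1 - (P.t j : ℂ) * u) 0 := fun j =>
    analyticAt_const.sub (analyticAt_const.mul analyticAt_id)
  have hnode : ∀ j, 1 - (P.t j : ℂ) * 0 ≠ 0 := fun j => by simp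
  have hf : AnalyticAt ℂ (fun u : ℂ => ∏ j, (1 - (P.t j : ℂ) * u)) 0 :=
    Finset.analyticAt_fun_prod _ fun j _ => hfac j
  obtain ⟨e, he, he0, hesq⟩ := hf.exists_sq_eq (Finset.prod_ne_zero_iff.mpr fun j _ => hnode j)
  have hprod : ∀ t : ℂ, t ≠ 0 → ∏ j, (t - (P.t j : ℂ)) = t ^ n * e t⁻¹ ^ 2 := by
    intro t ht
    rw [hesq]
    have : t ^ n = ∏ _j : Fin n, t := by simp
    rw [this, ← Finset.prod_mul_distrib]
    exact Finset.prod_congr rfl fun j _ => by field_simp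
  have hene : ∀ᶠ u in 𝓝 (0 : ℂ), e u ≠ 0 := he.continuousAt.eventually_ne he0
  have hene2 : ∀ᶠ w in 𝓝[≠] (0 : ℂ), e (w ^ 2) ≠ 0 :=
    tendsto_sq_nhdsNE.eventually (hene.filter_mono nhdsWithin_le_nhds)
  have hecont : ∀ᶠ w in 𝓝[≠] (0 : ℂ), ContinuousAt e (w ^ 2) :=
    tendsto_sq_nhdsNE.eventually
      ((he.eventually_analyticAt.mono fun _ h => h.continuousAt).filter_mono nhdsWithin_le_nhds)
  have i₀ : Fin n := ⟨0, by omega⟩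
  -- The value at `w = 0` is arbitrary: the point over `∞` is not on the affine curve, and only
  -- punctured neighbourhoods are used.
  let χ : ℂ → P.AffineCurve := fun w => if hw : w = 0 then P.affineVertex i₀ else
    ⟨((w ^ 2)⁻¹, (w ^ n)⁻¹ * e (w ^ 2)), by
      rw [hprod _ (inv_ne_zero (pow_ne_zero 2 hw)), inv_inv, mul_pow]
      congr 1
      rw [inv_pow, inv_pow, ← pow_mul, ← pow_mul, mul_comm]⟩
  have hχ : ∀ w, w ≠ 0 → (χ w).1 = ((w ^ 2)⁻¹, (w ^ n)⁻¹ * e (w ^ 2)) := by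
    intro w hw; simp [χ, hw]
  have hu : Tendsto (fun z : P.AffineCurve => (z.1.1)⁻¹) (P.vertexFilter none) (𝓝[≠] 0) := by
    have h := Filter.tendsto_inv₀_cobounded (α := ℂ)
    refine tendsto_nhdsWithin_iff.mpr ⟨h.comp tendsto_comap, ?_⟩
    have h2 := tendsto_comap (f := fun z : P.AffineCurve => z.1.1)
      (x := Bornology.cobounded ℂ) |>.eventually (Bornology.eventually_ne_cobounded 0)
    exact h2.mono fun z hz => inv_ne_zero hz
  have hwsq : ∀ z : P.AffineCurve, z.1.1 ≠ 0 → e (z.1.1)⁻¹ ≠ 0 →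
      (z.1.1 ^ m * e (z.1.1)⁻¹ / z.1.2) ^ 2 = (z.1.1)⁻¹ := by
    intro z h1 h2
    rw [div_pow, z.2, hprod _ h1, hpow']
    generalize e (z.1.1)⁻¹ = q at h2 ⊢
    field_simp
  have hgood : ∀ᶠ z in P.vertexFilter none, z.1.1 ≠ 0 ∧ e (z.1.1)⁻¹ ≠ 0 := by
    filter_upwards [hu.eventually (hene.filter_mono nhdsWithin_le_nhds),
      hu.eventually self_mem_nhdsWithin] with z h1 h2
    exact ⟨fun h => h2 (by simp [h]), h1⟩
  refine ⟨⟨χ, fun z => z.1.1 ^ m * e (z.1.1)⁻¹ / z.1.2, fun w => -2 * (w ^ 3)⁻¹, ?_, ?_, ?_, ?_, ?_,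
    ?_, ?_, ?_⟩⟩
  · refine tendsto_comap_iff.mpr ?_
    have h := Filter.tendsto_inv₀_nhdsNE_zero (α := ℂ) |>.comp tendsto_sq_nhdsNE
    refine h.congr' ?_
    filter_upwards [self_mem_nhdsWithin] with w hw
    simp [hχ w hw]
  · refine tendsto_nhdsWithin_iff.mpr ⟨?_, ?_⟩
    · rw [tendsto_zero_iff_norm_tendsto_zero]
      have h1 : Tendsto (fun z : P.AffineCurve => Real.sqrt ‖(z.1.1)⁻¹‖) (P.vertexFilter none)
          (𝓝 0) := by
        have := (Real.continuous_sqrt.tendsto _).comp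
          (tendsto_norm_zero.comp (hu.mono_right nhdsWithin_le_nhds))
        rwa [Real.sqrt_zero] at this
      refine h1.congr' ?_
      filter_upwards [hgood] with z hz
      have := congrArg norm (hwsq z hz.1 hz.2)
      rw [norm_pow] at this
      rw [← this, Real.sqrt_sq (norm_nonneg _)]
    · filter_upwards [hgood] with z hz h
      have h1 := hwsq z hz.1 hz.2
      rw [Set.mem_singleton_iff.mp h, zero_pow two_ne_zero] at h1
      exact inv_ne_zero hz.1 h1.symm
  · filter_upwards [hgood] with z hz
    have h2 := hwsq z hz.1 hz.2
    have hw0 : z.1.1 ^ m * e (z.1.1)⁻¹ / z.1.2 ≠ 0 := by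
      intro h
      rw [h, zero_pow two_ne_zero] at h2
      exact inv_ne_zero hz.1 h2.symm
    have hy : z.1.2 ≠ 0 := fun h => hw0 (by rw [h, div_zero])
    apply Subtype.ext
    rw [hχ _ hw0, hpow, h2, inv_inv]
    obtain ⟨h3, h4⟩ := hz
    refine Prod.ext rfl ?_
    simp only
    generalize e (z.1.1)⁻¹ = q at h4 ⊢
    rw [inv_pow]
    field_simp
  · filter_upwards [self_mem_nhdsWithin, hene2, hecont] with w hw h1 h2
    have hw' : w ≠ 0 := hw
    have hev : ∀ᶠ x in 𝓝 w, x ≠ 0 := isOpen_ne.mem_nhds hw'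
    refine ⟨?_, ?_, ?_, ?_⟩
    · rw [hχ w hw']
      exact mul_ne_zero (inv_ne_zero (pow_ne_zero _ hw')) h1
    · exact mul_ne_zero (by norm_num) (inv_ne_zero (pow_ne_zero _ hw'))
    · refine (Topology.IsInducing.continuousAt_iff (g := Subtype.val) ⟨rfl⟩).mpr ?_
      have h3 : ContinuousAt (fun w : ℂ => e (w ^ 2)) w :=
        ContinuousAt.comp (f := fun w : ℂ => w ^ 2) h2 (continuous_pow 2).continuousAt
      have h4 : ContinuousAt (fun w : ℂ => ((w ^ 2)⁻¹, (w ^ n)⁻¹ * e (w ^ 2))) w :=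
        ContinuousAt.prodMk (((continuous_pow 2).continuousAt).inv₀ (pow_ne_zero _ hw'))
          ((((continuous_pow n).continuousAt).inv₀ (pow_ne_zero _ hw')).mul h3)
      exact h4.congr (hev.mono fun x hx => (hχ x hx).symm)
    · have h3 : HasStrictDerivAt (fun w : ℂ => (w ^ 2)⁻¹) (-2 * (w ^ 3)⁻¹) w := by
        refine ((hasStrictDerivAt_zpow (-2) w (Or.inl hw')).congr_of_eventuallyEq
          (Eventually.of_forall fun x => ?_)).congr_deriv ?_
        · norm_cast
        · norm_num
      exact h3.congr_of_eventuallyEq (hev.mono fun x hx => by simp [hχ x hx])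
  · filter_upwards [self_mem_nhdsWithin] with w hw
    have hw' : w ≠ 0 := hw
    refine ⟨Subtype.ext ?_, ?_⟩
    · rw [hχ _ (neg_ne_zero.mpr hw')]
      simp only [swap, hχ w hw']
      refine Prod.ext (by simp) ?_
      rw [hpow, hpow, neg_sq]
      field_simp
    · field_simp
  · filter_upwards [self_mem_nhdsWithin] with w hw
    simp [hχ w hw, size]
  · intro A
    refine ⟨fun u => -2 * e u * ∏ j, (1 - (P.t j : ℂ) * u) ^ ((A.data (some j) - 1) / 2), ?_, ?_, ?_⟩
    · exact (analyticAt_const.mul he).mul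
        (Finset.analyticAt_fun_prod _ fun j _ => (hfac j).fun_zpow (hnode j))
    · exact mul_ne_zero (mul_ne_zero (by norm_num) he0)
        (Finset.prod_ne_zero_iff.mpr fun j _ => zpow_ne_zero _ (hnode j))
    · filter_upwards [self_mem_nhdsWithin] with w hw
      have hw' : w ≠ 0 := hw
      have hexp : ∀ j, (w ^ 2)⁻¹ ^ ((A.data (some j) - 1) / 2) = w ^ (1 - A.data (some j)) := by
        intro j
        obtain ⟨k, hk⟩ := A.odd_data (some j)
        have h2 : (A.data (some j) - 1) / 2 = k := by omega
        rw [h2, hk, inv_zpow, ← zpow_natCast, ← zpow_mul, ← zpow_neg]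
        congr 1; push_cast; ring
      have hpr : ∏ j, ((w ^ 2)⁻¹ - (P.t j : ℂ)) ^ ((A.data (some j) - 1) / 2) =
          w ^ (∑ j, (1 - A.data (some j))) *
            ∏ j, (1 - (P.t j : ℂ) * w ^ 2) ^ ((A.data (some j) - 1) / 2) := by
        have hsum : w ^ (∑ j, (1 - A.data (some j))) = ∏ j, w ^ (1 - A.data (some j)) := by
          generalize (Finset.univ : Finset (Fin n)) = s
          induction s using Finset.induction_on with
          | empty => simp
          | insert a s ha ih => rw [Finset.sum_insert ha, Finset.prod_insert ha, zpow_add₀ hw', ih]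
        rw [hsum, ← Finset.prod_mul_distrib]
        refine Finset.prod_congr rfl fun j _ => ?_
        rw [← hexp j, ← mul_zpow]
        congr 1
        field_simp
      simp only [Orthodisk.form, hχ w hw']
      rw [hpr, A.data_infty]
      have he1 : (∑ j, (1 - A.data (some j))) = n - ∑ j, A.data (some j) := by simp
      -- The exponent `a_∞ + 1` is the sum of `n - ∑ a_j` from the factors, `-n` from `y` and `-3`
      -- from `dt`.
      rw [he1, show -4 - ∑ j, A.data (some j) + 1 = (n - ∑ j, A.data (some j)) - n - 3 by ring,
        zpow_sub₀ hw' _ 3, zpow_sub₀ hw' _ (n : ℤ), zpow_natCast]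
      norm_cast
      field_simp
  · filter_upwards [self_mem_nhdsWithin] with w hw
    have hw' : w ≠ 0 := hw
    exact continuousAt_const.mul (((continuous_pow 3).continuousAt).inv₀ (pow_ne_zero _ hw'))

end ConformalPolygon

/-- Modulo 2 the relation for `a_∞` reads `a_∞ ≡ n`, because every `a_i` is odd. -/
theorem Orthodisk.odd_card {n : ℕ} {P : ConformalPolygon n} (A : Orthodisk P) : Odd n := by
  have h1 : (∑ i, A.data (some i) : ℤ) ≡ n [ZMOD 2] := by
    have : ((∑ i, A.data (some i) : ℤ)) ≡ ∑ _i : Fin n, 1 [ZMOD 2] := by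
      generalize (Finset.univ : Finset (Fin n)) = s
      induction s using Finset.induction_on with
      | empty => rfl
      | insert a s ha ih =>
        rw [Finset.sum_insert ha, Finset.sum_insert ha]
        exact Int.ModEq.add (Int.odd_iff.mp (A.odd_data (some a))) ih
    simpa using this
  have h2 := A.data_infty
  have h3 := Int.odd_iff.mp (A.odd_data none)
  rw [← Int.odd_coe_nat, Int.odd_iff]
  unfold Int.ModEq at h1
  omega

theorem Filter.Tendsto.map_eq_of_rightInverse {α β : Type*} {f : α → β} {g : β → α} {l : Filter α}
    {m : Filter β} (hf : Tendsto f l m) (hg : Tendsto g m l) (h : ∀ᶠ z in m, f (g z) = z) :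
    map f l = m := by
  refine le_antisymm hf fun s hs => ?_
  have h1 : ∀ᶠ z in m, f (g z) ∈ s := hg.eventually (mem_map.mp hs)
  filter_upwards [h, h1] with z h2 h3
  rwa [h2] at h3

namespace ConformalPolygon

variable {n : ℕ} {P : ConformalPolygon n}

theorem VertexChart.map_toFun {v : Option (Fin n)} (C : VertexChart P v) :
    map C.toFun (𝓝[≠] 0) = P.vertexFilter v :=
  C.tendsto_toFun.map_eq_of_rightInverse C.tendsto_inv C.toFun_inv

theorem VertexChart.map_coe {v : Option (Fin n)} (C : VertexChart P v) :
    map (fun w => (C.toFun w : OnePoint P.AffineCurve)) (𝓝[≠] 0) = 𝓝[≠] (P.vertexPoint v) := by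
  rw [← P.map_vertexFilter, ← C.map_toFun, map_map]; rfl

/-- The surface data are differentiable along local sections in `t`. Factoring a chart through the
local inverse of its `t`-coordinate transfers this to the parameter `w`. -/
theorem exists_isLocalSection {χ : ℂ → P.AffineCurve} {w d : ℂ} (hy : (χ w).1.2 ≠ 0) (hd : d ≠ 0)
    (hc : ContinuousAt χ w) (hτ : HasStrictDerivAt (fun w => (χ w).1.1) d w) :
    ∃ s, P.IsLocalSection s (χ w).1.1 ∧ s (χ w).1.1 = χ w ∧ ∀ᶠ z in 𝓝 w, χ z = s (χ z).1.1 := by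
  set τ : ℂ → ℂ := fun w => (χ w).1.1 with hτdef
  let g := hτ.localInverse τ d w hd
  have hgw : g (τ w) = w :=
    HasStrictFDerivAt.localInverse_apply_image (hτ.hasStrictFDerivAt_equiv hd)
  have hgc : ContinuousAt g (τ w) :=
    HasStrictFDerivAt.localInverse_continuousAt (hτ.hasStrictFDerivAt_equiv hd)
  have hr : ∀ᶠ t in 𝓝 (τ w), τ (g t) = t :=
    HasStrictFDerivAt.eventually_right_inverse (hτ.hasStrictFDerivAt_equiv hd)
  have hl : ∀ᶠ z in 𝓝 w, g (τ z) = z :=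
    HasStrictFDerivAt.eventually_left_inverse (hτ.hasStrictFDerivAt_equiv hd)
  refine ⟨fun t => χ (g t), ⟨?_, ?_, hr⟩, ?_, ?_⟩
  · change (χ (g (τ w))).1.2 ≠ 0
    rwa [hgw]
  · refine ContinuousAt.comp (f := g) (g := χ) ?_ hgc
    change ContinuousAt χ (g (τ w))
    rwa [hgw]
  · change χ (g (τ w)) = χ w
    rw [hgw]
  · filter_upwards [hl] with z hz
    change χ z = χ (g (τ z))
    rw [hz]

end ConformalPolygon

/-! ### The Weierstrass data in a vertex chart -/

open ConformalPolygon

theorem Orthodisk.form_ne_zero {n : ℕ} {P : ConformalPolygon n} (A : Orthodisk P)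
    {z : P.AffineCurve} (hz : z.1.2 ≠ 0) : A.form z ≠ 0 :=
  mul_ne_zero hz (Finset.prod_ne_zero_iff.mpr fun i _ =>
    zpow_ne_zero _ (sub_ne_zero_of_snd_ne_zero hz i))

namespace OrthodiskSurface

variable {n : ℕ} {P : ConformalPolygon n} {A B : Orthodisk P} (S : OrthodiskSurface A B)

theorem G_ne_zero {z : P.AffineCurve} (hz : z.1.2 ≠ 0) : S.G z ≠ 0 := fun h => by
  have := S.G_mul_dh z hz
  rw [h, zero_mul] at this
  exact mul_ne_zero S.c₁_ne_zero (A.form_ne_zero hz) this.symm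

/-- Multiplying the two defining equations eliminates `G`. Explicit formulas for `dh` then follow by
choosing a sign on a connected set. -/
theorem dh_sq {z : P.AffineCurve} (hz : z.1.2 ≠ 0) :
    S.dh z ^ 2 = (S.c₁ * A.form z) * (S.c₂ * B.form z) := by
  rw [← S.G_mul_dh z hz, ← S.inv_G_mul_dh z hz]
  have := S.G_ne_zero hz
  field_simp

theorem dh_ne_zero {z : P.AffineCurve} (hz : z.1.2 ≠ 0) : S.dh z ≠ 0 := fun h => by
  have := S.G_mul_dh z hz
  rw [h, mul_zero] at this
  exact mul_ne_zero S.c₁_ne_zero (A.form_ne_zero hz) this.symm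

theorem hasFDerivAt_comp {χ : ℂ → P.AffineCurve} {w d : ℂ} (hy : (χ w).1.2 ≠ 0) (hd : d ≠ 0)
    (hc : ContinuousAt χ w) (hτ : HasStrictDerivAt (fun w => (χ w).1.1) d w) :
    HasFDerivAt (fun z => S.X (χ z : OnePoint P.AffineCurve) 0)
      (reMul ((S.c₁ * A.form (χ w) * d - S.c₂ * B.form (χ w) * d) / 2)) w ∧
    HasFDerivAt (fun z => S.X (χ z : OnePoint P.AffineCurve) 1)
      (reMul (Complex.I * (S.c₁ * A.form (χ w) * d + S.c₂ * B.form (χ w) * d) / 2)) w ∧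
    HasFDerivAt (fun z => S.X (χ z : OnePoint P.AffineCurve) 2) (reMul (S.dh (χ w) * d)) w := by
  obtain ⟨s, hs, hsw, hev⟩ := exists_isLocalSection hy hd hc hτ
  have key : ∀ k : Fin 3, HasFDerivAt (fun z => S.X (χ z : OnePoint P.AffineCurve) k)
      (reMul (![(S.G (χ w) - (S.G (χ w))⁻¹) * S.dh (χ w) / 2,
        Complex.I * (S.G (χ w) + (S.G (χ w))⁻¹) * S.dh (χ w) / 2, S.dh (χ w)] k * d)) w := by
    intro k
    have h1 := S.hasFDerivAt_X _ s hs k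
    rw [hsw] at h1
    have h2 := h1.comp w (hτ.hasDerivAt.hasFDerivAt.restrictScalars ℝ)
    refine (h2.congr_of_eventuallyEq ?_).congr_fderiv ?_
    · filter_upwards [hev] with z hz
      simp only [Function.comp_apply]
      rw [← hz]
    · ext z
      simp only [ContinuousLinearMap.comp_apply, reMul_apply]
      simp
      ring
  rw [← S.G_mul_dh _ hy, ← S.inv_G_mul_dh _ hy]
  refine ⟨(key 0).congr_fderiv ?_, (key 1).congr_fderiv ?_, (key 2).congr_fderiv ?_⟩
  · congr 1; simp only [Matrix.cons_val]; ring
  · congr 1; simp only [Matrix.cons_val]; ring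
  · rfl

theorem continuousAt_dh_comp {χ : ℂ → P.AffineCurve} {w d : ℂ} (hy : (χ w).1.2 ≠ 0) (hd : d ≠ 0)
    (hc : ContinuousAt χ w) (hτ : HasStrictDerivAt (fun w => (χ w).1.1) d w) :
    ContinuousAt (fun z => S.dh (χ z)) w := by
  obtain ⟨s, hs, hsw, hev⟩ := exists_isLocalSection hy hd hc hτ
  have h1 : ContinuousAt (fun t => S.dh (s t)) (χ w).1.1 :=
    (S.holomorphic_dh _ s hs).continuousAt
  have h2 : ContinuousAt (fun z => S.dh (s (χ z).1.1)) w :=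
    ContinuousAt.comp (f := fun z => (χ z).1.1) (g := fun t => S.dh (s t)) h1
      hτ.hasDerivAt.continuousAt
  refine h2.congr ?_
  filter_upwards [hev] with z hz
  rw [← hz]

/-- The height differential in a chart at a vertex. -/
theorem exists_dh_eq {v : Option (Fin n)} (C : VertexChart P v) :
    ∃ q : ℂ → ℂ, AnalyticAt ℂ q 0 ∧ q 0 ≠ 0 ∧ ∀ᶠ w in 𝓝[≠] (0 : ℂ),
      S.dh (C.toFun w) * C.deriv w = w ^ ((A.data v + B.data v) / 2 + 1) * q (w ^ 2) := by
  obtain ⟨eA, hA, hA0, hAe⟩ := C.form_eq A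
  obtain ⟨eB, hB, hB0, hBe⟩ := C.form_eq B
  obtain ⟨q, hq, hq0, hqsq⟩ := (((analyticAt_const (v := S.c₁)).mul hA).mul
    ((analyticAt_const (v := S.c₂)).mul hB)).exists_sq_eq
    (mul_ne_zero (mul_ne_zero S.c₁_ne_zero hA0) (mul_ne_zero S.c₂_ne_zero hB0))
  have hcont : ∀ᶠ w in 𝓝[≠] (0 : ℂ), q (w ^ 2) ≠ 0 ∧ ContinuousAt q (w ^ 2) :=
    tendsto_sq_nhdsNE.eventually (((hq.continuousAt.eventually_ne hq0).and
      (hq.eventually_analyticAt.mono fun _ h => h.continuousAt)).filter_mono nhdsWithin_le_nhds)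
  obtain ⟨r, hr, hgood⟩ := exists_radius_of_eventually
    (hAe.and (hBe.and (hcont.and (C.regular.and C.continuousAt_deriv))))
  set m : ℤ := (A.data v + B.data v) / 2 + 1 with hm
  have hm2 : A.data v + 1 + (B.data v + 1) = m * 2 := by
    have h1 := Int.odd_iff.mp (A.odd_data v)
    have h2 := Int.odd_iff.mp (B.odd_data v)
    omega
  have hsq : Set.EqOn ((fun w => S.dh (C.toFun w) * C.deriv w) ^ 2)
      ((fun w : ℂ => w ^ m * q (w ^ 2)) ^ 2) {w : ℂ | w ≠ 0 ∧ ‖w‖ < r} := by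
    intro w hw
    obtain ⟨h1, h2, h3, h4, -⟩ := hgood w hw.1 hw.2
    simp only [Pi.pow_apply]
    have hw2 : (w ^ m) ^ 2 = w ^ (A.data v + 1) * w ^ (B.data v + 1) := by
      rw [← zpow_add₀ hw.1, hm2, zpow_mul]; norm_cast
    rw [mul_pow, S.dh_sq h4.1, mul_pow, hqsq, hw2]
    simp only [Pi.mul_apply]
    linear_combination (S.c₁ * S.c₂ * (B.form (C.toFun w) * C.deriv w)) * h1 +
      (S.c₁ * S.c₂ * (w ^ (A.data v + 1) * eA (w ^ 2))) * h2
  have h1 : ContinuousOn (fun w => S.dh (C.toFun w) * C.deriv w) {w : ℂ | w ≠ 0 ∧ ‖w‖ < r} := by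
    intro w hw
    obtain ⟨-, -, -, h4, h5⟩ := hgood w hw.1 hw.2
    exact ((S.continuousAt_dh_comp h4.1 h4.2.1 h4.2.2.1 h4.2.2.2).mul h5).continuousWithinAt
  have h2 : ContinuousOn (fun w : ℂ => w ^ m * q (w ^ 2)) {w : ℂ | w ≠ 0 ∧ ‖w‖ < r} := by
    intro w hw
    obtain ⟨-, -, h3, -⟩ := hgood w hw.1 hw.2
    exact ((continuousAt_zpow₀ w m (Or.inl hw.1)).mul (ContinuousAt.comp (f := fun w : ℂ => w ^ 2)
      h3.2 (continuous_pow 2).continuousAt)).continuousWithinAt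
  -- Two continuous square roots of a nonvanishing function on a connected set agree up to a global
  -- sign, which `q` absorbs.
  rcases (isPreconnected_puncturedBall r).eq_or_eq_neg_of_sq_eq h1 h2 hsq
    (fun {w} hw => mul_ne_zero (zpow_ne_zero _ hw.1) (hgood w hw.1 hw.2).2.2.1.1) with h | h
  · exact ⟨q, hq, hq0, eventually_of_radius hr fun w h1 h2 => h ⟨h1, h2⟩⟩
  · refine ⟨fun u => -q u, hq.neg, neg_ne_zero.mpr hq0,
      eventually_of_radius hr fun w h1 h2 => ?_⟩
    rw [mul_neg]
    exact h ⟨h1, h2⟩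

/-- The hyperelliptic involution acts on `dh` by a sign, which is determined by the data at any
vertex. -/
theorem eventually_dh_swap {v : Option (Fin n)} (C : VertexChart P v) :
    ∀ᶠ z in P.vertexFilter v,
      S.dh (P.swap z) = (-1) ^ ((A.data v + B.data v) / 2) * S.dh z := by
  obtain ⟨q, -, -, hq⟩ := S.exists_dh_eq C
  rw [← C.map_toFun, eventually_map]
  have hneg : Tendsto (fun w : ℂ => -w) (𝓝[≠] 0) (𝓝[≠] 0) := by
    refine tendsto_nhdsWithin_iff.mpr ⟨?_, ?_⟩
    · have : Tendsto (fun w : ℂ => -w) (𝓝 0) (𝓝 (-0)) := continuous_neg.tendsto 0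
      rw [neg_zero] at this
      exact this.mono_left nhdsWithin_le_nhds
    · filter_upwards [self_mem_nhdsWithin] with w hw
      simpa using hw
  filter_upwards [hq, hneg.eventually hq, C.toFun_neg, C.regular] with w h1 h2 h3 h4
  -- The `+ 1` in the exponent of `w` is cancelled by the oddness of `deriv`, leaving the sign `(-1)
  -- ^ ((a + b) / 2)`.
  rw [h3.1, h3.2, neg_sq, neg_eq_neg_one_mul w, mul_zpow, zpow_add₀ (by norm_num), zpow_one] at h2
  have hd := h4.2.1
  apply mul_right_cancel₀ hd
  linear_combination (-1) * h2 + (-1) ^ ((A.data v + B.data v) / 2) * (-1) * h1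

end OrthodiskSurface

/-! ### From a chart to an embedded end -/

/-- The vertical unit vector. -/
noncomputable def verticalUnit : EuclideanSpace ℝ (Fin 3) := EuclideanSpace.single 2 1

theorem norm_verticalUnit : ‖verticalUnit‖ = 1 := by simp [verticalUnit]

theorem inner_verticalUnit (x : EuclideanSpace ℝ (Fin 3)) : inner ℝ x verticalUnit = x 2 := by
  simp [verticalUnit, EuclideanSpace.inner_single_right]

/-- The point of the horizontal coordinate plane with a given complex coordinate. -/
noncomputable def planePoint (z : ℂ) : EuclideanSpace ℝ (Fin 3) := !₂[z.re, z.im, 0]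

theorem norm_planePoint (z : ℂ) : ‖planePoint z‖ = ‖z‖ := by
  rw [EuclideanSpace.norm_eq, Complex.norm_def, Complex.normSq_apply, Fin.sum_univ_three]
  simp [planePoint, sq]

theorem horizontalPart_verticalUnit (x : EuclideanSpace ℝ (Fin 3)) :
    horizontalPart verticalUnit x = planePoint ((x 0 : ℂ) + x 1 * Complex.I) := by
  ext k
  rw [horizontalPart, inner_verticalUnit]
  fin_cases k <;> simp [verticalUnit, planePoint]

theorem bijOn_planePoint (R : ℝ) : Set.BijOn planePoint {z | R < ‖z‖}
    {x | inner ℝ x verticalUnit = 0 ∧ R < ‖x‖} := by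
  refine ⟨fun z hz => ⟨?_, ?_⟩, fun z _ w _ h => ?_, fun x hx => ?_⟩
  · rw [inner_verticalUnit]; simp [planePoint]
  · rw [norm_planePoint]; exact hz
  · have h0 := congrArg (fun x => x 0) h
    have h1 := congrArg (fun x => x 1) h
    simp [planePoint] at h0 h1
    exact Complex.ext h0 h1
  · have h2 : x = planePoint ((x 0 : ℂ) + x 1 * Complex.I) := by
      rw [← horizontalPart_verticalUnit, horizontalPart, hx.1, zero_smul, sub_zero]
    refine ⟨_, ?_, h2.symm⟩
    have := hx.2
    rw [h2, norm_planePoint] at this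
    exact this

theorem IsEmbeddedEnd.neg {Z : Type*} [TopologicalSpace Z] {X : Z → EuclideanSpace ℝ (Fin 3)} {p : Z}
    {ν : EuclideanSpace ℝ (Fin 3)} {α β : ℝ} (h : IsEmbeddedEnd X p ν α β) :
    IsEmbeddedEnd X p (-ν) (-α) (-β) := by
  have hh : ∀ x, horizontalPart (-ν) x = horizontalPart ν x := fun x => by
    simp [horizontalPart, inner_neg_right]
  obtain ⟨h1, ⟨R, hR, U, hU, hb⟩, h3⟩ := h
  refine ⟨by simpa only [hh] using h1, ⟨R, hR, U, hU, ?_⟩, ?_⟩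
  · simpa only [hh, inner_neg_right, neg_eq_zero] using hb
  · refine h3.neg.congr fun z => ?_
    rw [hh, inner_neg_right]
    ring

/-- Since `log ‖H‖ = -log ‖w‖ + γ + o(1)`, a height `ρ log ‖w‖` becomes growth rate `-ρ`. The second
conclusion restates this asymptotic relation through `t`, with factor `1 / 2` as `size = ‖w‖²`; it
lets the growth rate be read off without the chart. -/
theorem isEmbeddedEnd_of_chart {n : ℕ} {P : ConformalPolygon n} {v : Option (Fin n)}
    (C : VertexChart P v) (X : P.Curve → EuclideanSpace ℝ (Fin 3))
    (hH : IsPoleLike fun w => (X (C.toFun w : OnePoint P.AffineCurve) 0 : ℂ) +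
      X (C.toFun w : OnePoint P.AffineCurve) 1 * Complex.I) {ρ β₀ : ℝ}
    (hu : Tendsto (fun w => X (C.toFun w : OnePoint P.AffineCurve) 2 - ρ * Real.log ‖w‖)
      (𝓝[≠] 0) (𝓝 β₀)) :
    (∃ β, IsEmbeddedEnd X (P.vertexPoint v) verticalUnit (-ρ) β) ∧
      ∃ γ, Tendsto (fun z : P.AffineCurve =>
        Real.log ‖horizontalPart verticalUnit (X (z : OnePoint P.AffineCurve))‖ +
          1 / 2 * Real.log (P.size v z.1.1)) (P.vertexFilter v) (𝓝 γ) := by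
  obtain ⟨hbij, hinf, γ, hγ⟩ := hH
  have hnorm : ∀ z, ‖horizontalPart verticalUnit (X z)‖ = ‖(X z 0 : ℂ) + X z 1 * Complex.I‖ :=
    fun z => by rw [horizontalPart_verticalUnit, norm_planePoint]
  refine ⟨⟨β₀ + ρ * γ, ?_, ?_, ?_⟩, γ, ?_⟩
  · rw [← C.map_coe, tendsto_map'_iff]
    refine hinf.congr fun w => ?_
    simp only [Function.comp_apply, hnorm]
  · have hne : ∀ᶠ w in 𝓝[≠] (0 : ℂ), (C.toFun w : OnePoint P.AffineCurve) ≠ P.vertexPoint v := by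
      have : ∀ᶠ z in 𝓝[≠] (P.vertexPoint v), z ≠ P.vertexPoint v := self_mem_nhdsWithin
      rwa [← C.map_coe, eventually_map] at this
    obtain ⟨R, hR, V, hV, hVW, hb⟩ := hbij _ (eventually_nhdsWithin_iff.mp hne)
    set f : ℂ → P.Curve := fun w => (C.toFun w : OnePoint P.AffineCurve) with hf
    have hU : f '' (V \ {0}) ∈ 𝓝[≠] (P.vertexPoint v) := by
      rw [← C.map_coe]
      exact image_mem_map (sdiff_mem_nhdsWithin_compl hV _)
    refine ⟨R, hR, insert (P.vertexPoint v) (f '' (V \ {0})), insert_mem_nhds_iff.mpr hU, ?_⟩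
    have hset : insert (P.vertexPoint v) (f '' (V \ {0})) \ {P.vertexPoint v} = f '' (V \ {0}) := by
      refine Set.insert_sdiff_self_of_notMem ?_
      rintro ⟨w, hw, hwv⟩
      exact hVW hw.1 hw.2 hwv
    rw [hset]
    have hcomp : Set.BijOn ((fun z => horizontalPart verticalUnit (X z)) ∘ f) (V \ {0})
        {x | inner ℝ x verticalUnit = 0 ∧ R < ‖x‖} :=
      ((bijOn_planePoint R).comp hb).congr fun w _ => (horizontalPart_verticalUnit _).symm
    refine ⟨?_, hcomp.injOn.image_of_comp, ?_⟩
    · rintro _ ⟨w, hw, rfl⟩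
      exact hcomp.mapsTo hw
    · intro x hx
      obtain ⟨w, hw, hwx⟩ := hcomp.surjOn hx
      exact ⟨f w, ⟨w, hw, rfl⟩, hwx⟩
  · rw [← C.map_coe, tendsto_map'_iff]
    refine (hu.add (hγ.const_mul ρ)).congr fun w => ?_
    simp only [Function.comp_apply, hnorm, inner_verticalUnit]
    ring
  · rw [← C.map_toFun, tendsto_map'_iff]
    refine hγ.congr' ?_
    filter_upwards [C.size_eq] with w hw
    simp only [Function.comp_apply, hnorm]
    rw [hw, Real.log_pow]
    push_cast
    ring

namespace OrthodiskSurface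

variable {n : ℕ} {P : ConformalPolygon n} {A B : Orthodisk P} (S : OrthodiskSurface A B)

/-- A vertex with a double pole of exactly one of the two forms, at which `dh` has at most a simple
pole, is an embedded end, with a vertical limit normal; it is planar if `dh` has no pole. -/
theorem exists_isEmbeddedEnd {v : Option (Fin n)} (C : VertexChart P v)
    (hv : (A.data v = -3 ∧ -1 ≤ B.data v) ∨ (B.data v = -3 ∧ -1 ≤ A.data v)) :
    ∃ α, (A.data v + B.data v = 0 → α = 0) ∧
      (∃ β, IsEmbeddedEnd S.X (P.vertexPoint v) verticalUnit α β) ∧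
      ∃ γ, Tendsto (fun z : P.AffineCurve =>
        Real.log ‖horizontalPart verticalUnit (S.X (z : OnePoint P.AffineCurve))‖ +
          1 / 2 * Real.log (P.size v z.1.1)) (P.vertexFilter v) (𝓝 γ) := by
  have hder := C.regular.mono fun w h => S.hasFDerivAt_comp h.1 h.2.1 h.2.2.1 h.2.2.2
  obtain ⟨q, hq, -, hqe⟩ := S.exists_dh_eq C
  have hpoly : ∀ {e : ℂ → ℂ} (k : ℕ), AnalyticAt ℂ e 0 →
      AnalyticAt ℂ (fun w : ℂ => w ^ k * e (w ^ 2)) 0 := fun k he =>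
    (analyticAt_id.pow k).mul (AnalyticAt.comp_of_eq he (analyticAt_id.pow 2) (by simp))
  have hH : IsPoleLike fun w => (S.X (C.toFun w : OnePoint P.AffineCurve) 0 : ℂ) +
      S.X (C.toFun w : OnePoint P.AffineCurve) 1 * Complex.I := by
    obtain ⟨eA, hA, hA0, hAe⟩ := C.form_eq A
    obtain ⟨eB, hB, hB0, hBe⟩ := C.form_eq B
    have hpole : ∀ w : ℂ, w ^ (-3 + 1 : ℤ) = (w ^ 2)⁻¹ := fun w => by
      norm_num
    rcases hv with ⟨h1, h2⟩ | ⟨h1, h2⟩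
    · obtain ⟨k, hk⟩ := Int.eq_ofNat_of_zero_le (show 0 ≤ B.data v + 1 by omega)
      refine isPoleLike_of_weierstrass (hder.mono fun w h => h.1) (hder.mono fun w h => h.2.1)
        ((analyticAt_const (v := S.c₁)).mul hA) (mul_ne_zero S.c₁_ne_zero hA0)
        ((analyticAt_const (v := S.c₂)).mul (hpoly k hB)) (Or.inl ?_)
      filter_upwards [hAe, hBe] with w h3 h4
      simp only [Pi.mul_apply]
      rw [mul_assoc, h3, mul_assoc, h4, h1, hk, hpole, zpow_natCast]
      exact ⟨by ring, rfl⟩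
    · obtain ⟨k, hk⟩ := Int.eq_ofNat_of_zero_le (show 0 ≤ A.data v + 1 by omega)
      refine isPoleLike_of_weierstrass (hder.mono fun w h => h.1) (hder.mono fun w h => h.2.1)
        ((analyticAt_const (v := S.c₂)).mul hB) (mul_ne_zero S.c₂_ne_zero hB0)
        ((analyticAt_const (v := S.c₁)).mul (hpoly k hA)) (Or.inr ?_)
      filter_upwards [hAe, hBe] with w h3 h4
      simp only [Pi.mul_apply]
      rw [mul_assoc, h4, mul_assoc, h3, h1, hk, hpole, zpow_natCast]
      exact ⟨by ring, rfl⟩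
  -- In the chart `dh = w ^ (k - 1) q(w²) dw`, so the residue is the value of `w ^ k q(w²)` at `0`.
  -- It vanishes for `a + b = 0`, where `k = 2`.
  obtain ⟨k, hk⟩ := Int.eq_ofNat_of_zero_le
    (show 0 ≤ (A.data v + B.data v) / 2 + 2 by omega)
  obtain ⟨β₀, hβ⟩ := tendsto_sub_log_of_simple_pole
    (u := fun w => S.X (C.toFun w : OnePoint P.AffineCurve) 2) (hpoly k hq) (by
      filter_upwards [hder, hqe, self_mem_nhdsWithin] with w h1 h2 hw
      have hw' : w ≠ 0 := hw
      rw [show (A.data v + B.data v) / 2 + 1 = k - 1 by omega, zpow_sub₀ hw', zpow_one,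
        zpow_natCast] at h2
      refine h1.2.2.congr_fderiv ?_
      rw [h2]
      congr 1
      field_simp)
  obtain ⟨h1, h2⟩ := isEmbeddedEnd_of_chart C S.X hH hβ
  refine ⟨_, fun h0 => ?_, h1, h2⟩
  have hk0 : k ≠ 0 := by
    rintro rfl
    rw [h0] at hk
    norm_num at hk
  simp [hk0]

end OrthodiskSurface

/-! ### The sheet over the upper half-plane and the approach to its boundary -/

/-- The open upper half-plane, as a set. -/
def upperHalf : Set ℂ := {t | 0 < t.im}

theorem isOpen_upperHalf : IsOpen upperHalf := isOpen_lt continuous_const Complex.continuous_im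

theorem isPreconnected_upperHalf : IsPreconnected upperHalf :=
  (convex_halfSpace_im_gt 0).isPreconnected

theorem sub_ofReal_mem_slitPlane {t : ℂ} (ht : t ∈ upperHalf) (x : ℝ) :
    t - x ∈ Complex.slitPlane := by
  refine Complex.mem_slitPlane_iff.mpr (Or.inr ?_)
  have : 0 < t.im := ht
  simpa using this.ne'

theorem ofReal_sub_mem_slitPlane {t : ℂ} (ht : t ∈ upperHalf) (x : ℝ) :
    (x : ℂ) - t ∈ Complex.slitPlane := by
  refine Complex.mem_slitPlane_iff.mpr (Or.inr ?_)
  have : 0 < t.im := ht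
  simpa using this.ne'

theorem add_mul_exp_mem_upperHalf (x : ℝ) {ρ θ : ℝ} (hρ : 0 < ρ) (h0 : 0 < θ) (hπ : θ < Real.pi) :
    (x : ℂ) + ρ * Complex.exp (θ * Complex.I) ∈ upperHalf := by
  change 0 < ((x : ℂ) + ρ * Complex.exp (θ * Complex.I)).im
  rw [Complex.add_im, Complex.ofReal_im, Complex.im_ofReal_mul, Complex.exp_ofReal_mul_I_im]
  have := Real.sin_pos_of_pos_of_lt_pi h0 hπ
  positivity

theorem tendsto_ray (x : ℝ) {θ : ℝ} (h0 : 0 < θ) (hπ : θ < Real.pi) :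
    Tendsto (fun ρ : ℝ => (x : ℂ) + ρ * Complex.exp (θ * Complex.I)) (𝓝[>] 0)
      (𝓝[upperHalf] (x : ℂ)) := by
  refine tendsto_nhdsWithin_iff.mpr ⟨?_, ?_⟩
  · have hc : Continuous (fun ρ : ℝ => (x : ℂ) + ρ * Complex.exp (θ * Complex.I)) := by fun_prop
    have := hc.tendsto 0
    simp only [Complex.ofReal_zero, zero_mul, add_zero] at this
    exact this.mono_left nhdsWithin_le_nhds
  · filter_upwards [self_mem_nhdsWithin] with ρ hρ
    exact add_mul_exp_mem_upperHalf x hρ h0 hπ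

theorem eq_zero_of_tendsto_mul {ι : Type*} {l : Filter ι} [l.NeBot] {f : ι → ℝ} {a b : ℝ}
    (hf : Tendsto f l atBot) (h : Tendsto (fun x => a * f x) l (𝓝 b)) : a = 0 := by
  by_contra ha
  rcases lt_or_gt_of_ne ha with h1 | h1
  · exact not_tendsto_nhds_of_tendsto_atTop (hf.const_mul_atBot_of_neg h1) _ h
  · exact not_tendsto_nhds_of_tendsto_atBot (hf.const_mul_atBot h1) _ h

namespace ConformalPolygon

variable {n : ℕ} (P : ConformalPolygon n)

/-- The sheet of the hyperelliptic surface over the upper half-plane on which `y` is the product of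
the principal square roots. -/
noncomputable def sheet (t : ℂ) : P.AffineCurve :=
  ⟨(t, ∏ i, (t - (P.t i : ℂ)) ^ (((2 : ℕ) : ℂ)⁻¹)), by
    rw [← Finset.prod_pow]
    exact Finset.prod_congr rfl fun i _ => Complex.cpow_nat_inv_pow _ two_ne_zero⟩

@[simp] theorem sheet_fst (t : ℂ) : (P.sheet t).1.1 = t := rfl

theorem sub_ne_zero_of_mem_upperHalf {t : ℂ} (ht : t ∈ upperHalf) (i : Fin n) :
    t - (P.t i : ℂ) ≠ 0 := Complex.slitPlane_ne_zero (sub_ofReal_mem_slitPlane ht _)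

theorem sheet_snd_ne_zero {t : ℂ} (ht : t ∈ upperHalf) : (P.sheet t).1.2 ≠ 0 := by
  intro h
  have h1 := (P.sheet t).2
  rw [h, zero_pow two_ne_zero] at h1
  exact Finset.prod_ne_zero_iff.mpr (fun i _ => P.sub_ne_zero_of_mem_upperHalf ht i) h1.symm

theorem continuousAt_sheet {t : ℂ} (ht : t ∈ upperHalf) : ContinuousAt P.sheet t := by
  refine (Topology.IsInducing.continuousAt_iff (g := Subtype.val) ⟨rfl⟩).mpr ?_
  refine ContinuousAt.prodMk continuousAt_id (tendsto_finsetProd _ fun i _ => ?_)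
  exact ContinuousAt.cpow (by fun_prop) continuousAt_const (sub_ofReal_mem_slitPlane ht _)

theorem hasStrictDerivAt_sheet (t : ℂ) :
    HasStrictDerivAt (fun t => (P.sheet t).1.1) 1 t := hasStrictDerivAt_id t

/-- The filter of approach to a vertex within the upper half-plane. -/
noncomputable def boundaryFilter : Option (Fin n) → Filter ℂ
  | none => Bornology.cobounded ℂ ⊓ 𝓟 upperHalf
  | some i => 𝓝[upperHalf] (P.t i : ℂ)

theorem eventually_mem_upperHalf (v : Option (Fin n)) :
    ∀ᶠ t in P.boundaryFilter v, t ∈ upperHalf := by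
  cases v with
  | none => exact mem_inf_of_right (mem_principal_self _)
  | some i => exact self_mem_nhdsWithin

theorem boundaryFilter_neBot (v : Option (Fin n)) : (P.boundaryFilter v).NeBot := by
  cases v with
  | none =>
    have h : Tendsto (fun ρ : ℝ => (ρ : ℂ) * Complex.I) atTop (P.boundaryFilter none) := by
      refine tendsto_inf.mpr ⟨?_, tendsto_principal.mpr ?_⟩
      · rw [← tendsto_norm_atTop_iff_cobounded]
        refine tendsto_id.congr' ?_
        filter_upwards [eventually_ge_atTop 0] with ρ hρ
        simp [abs_of_nonneg hρ]
      · filter_upwards [eventually_gt_atTop 0] with ρ hρ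
        change 0 < ((ρ : ℂ) * Complex.I).im
        simpa using hρ
    exact h.neBot
  | some i => exact (tendsto_ray (P.t i) one_pos (by linarith [Real.pi_gt_three])).neBot

theorem tendsto_sheet (v : Option (Fin n)) :
    Tendsto P.sheet (P.boundaryFilter v) (P.vertexFilter v) := by
  cases v with
  | none => exact tendsto_comap_iff.mpr (tendsto_inf_left tendsto_id)
  | some i =>
    refine tendsto_nhdsWithin_iff.mpr ⟨tendsto_subtype_rng.mpr ?_, ?_⟩
    · have hid : Tendsto (fun t : ℂ => t) (𝓝[upperHalf] (P.t i : ℂ)) (𝓝 (P.t i : ℂ)) :=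
        nhdsWithin_le_nhds
      refine hid.prodMk_nhds ?_
      rw [tendsto_zero_iff_norm_tendsto_zero]
      have h1 : Continuous fun t : ℂ => Real.sqrt ‖∏ j, (t - (P.t j : ℂ))‖ := by fun_prop
      have h2 := (h1.tendsto (P.t i : ℂ)).mono_left (nhdsWithin_le_nhds (s := upperHalf))
      rw [Finset.prod_eq_zero (Finset.mem_univ i) (sub_self _), norm_zero, Real.sqrt_zero] at h2
      refine h2.congr fun t => ?_
      have h3 := (P.sheet t).2
      rw [sheet_fst] at h3
      rw [← h3, norm_pow, Real.sqrt_sq (norm_nonneg _)]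
      rfl
    · filter_upwards [self_mem_nhdsWithin] with t ht h
      have h1 : t = P.t i := congrArg (fun z : P.AffineCurve => z.1.1) h
      have h2 : 0 < t.im := ht
      rw [h1] at h2
      simp at h2

theorem tendsto_log_size (v : Option (Fin n)) :
    Tendsto (fun t => Real.log (P.size v t)) (P.boundaryFilter v) atBot := by
  cases v with
  | none =>
    have h : Tendsto (fun t : ℂ => -Real.log ‖t‖) (P.boundaryFilter none) atBot :=
      tendsto_neg_atTop_atBot.comp (Real.tendsto_log_atTop.comp
        (tendsto_inf_left tendsto_norm_cobounded_atTop))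
    exact h.congr fun t => (Real.log_inv _).symm
  | some i =>
    have h1 : Tendsto (fun t : ℂ => t - (P.t i : ℂ)) (𝓝[upperHalf] (P.t i : ℂ)) (𝓝[≠] 0) := by
      refine tendsto_nhdsWithin_iff.mpr ⟨?_, ?_⟩
      · have hc : Continuous fun t : ℂ => t - (P.t i : ℂ) := by fun_prop
        have := hc.tendsto (P.t i : ℂ)
        rw [sub_self] at this
        exact this.mono_left nhdsWithin_le_nhds
      · filter_upwards [self_mem_nhdsWithin] with t ht
        exact P.sub_ne_zero_of_mem_upperHalf ht i
    exact Real.tendsto_log_nhdsGT_zero.comp (tendsto_norm_nhdsNE_zero.comp h1)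

end ConformalPolygon

/-! ### Divisibility by four and the height over the upper half-plane -/

theorem Orthodisk.form_swap {n : ℕ} {P : ConformalPolygon n} (A : Orthodisk P) (z : P.AffineCurve) :
    A.form (P.swap z) = -A.form z := neg_mul _ _

/-- The factor `y²` raises each exponent `(a - 1) / 2 + (b - 1) / 2` by one, to `(a + b) / 2`, which
is even by hypothesis. So `dh` becomes a rational function of `t` on the sheet. -/
theorem Orthodisk.form_mul_form {n : ℕ} {P : ConformalPolygon n} (A B : Orthodisk P)
    (h4 : ∀ i, (A.data (some i) + B.data (some i)) % 4 = 0) {z : P.AffineCurve} (hz : z.1.2 ≠ 0) :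
    A.form z * B.form z =
      (∏ i, (z.1.1 - (P.t i : ℂ)) ^ ((A.data (some i) + B.data (some i)) / 4)) ^ 2 := by
  unfold Orthodisk.form
  rw [← Finset.prod_pow, mul_mul_mul_comm, ← sq, z.2, ← Finset.prod_mul_distrib,
    ← Finset.prod_mul_distrib]
  refine Finset.prod_congr rfl fun i _ => ?_
  have hne := sub_ne_zero_of_snd_ne_zero hz i
  obtain ⟨k, hk⟩ := A.odd_data (some i)
  obtain ⟨l, hl⟩ := B.odd_data (some i)
  have := h4 i
  rw [← zpow_add₀ hne, ← zpow_natCast, ← zpow_mul, ← zpow_one_add₀ hne]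
  congr 1
  push_cast
  omega

namespace OrthodiskSurface

variable {n : ℕ} {P : ConformalPolygon n} {A B : Orthodisk P} (S : OrthodiskSurface A B)

theorem continuousAt_dh_sheet {t : ℂ} (ht : t ∈ upperHalf) :
    ContinuousAt (fun t => S.dh (P.sheet t)) t :=
  S.continuousAt_dh_comp (P.sheet_snd_ne_zero ht) one_ne_zero (P.continuousAt_sheet ht)
    (P.hasStrictDerivAt_sheet t)

theorem continuousAt_dh_swap_sheet {t : ℂ} (ht : t ∈ upperHalf) :
    ContinuousAt (fun t => S.dh (P.swap (P.sheet t))) t :=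
  S.continuousAt_dh_comp (χ := fun t => P.swap (P.sheet t))
    (neg_ne_zero.mpr (P.sheet_snd_ne_zero ht)) one_ne_zero
    (P.continuous_swap.continuousAt.comp (P.continuousAt_sheet ht)) (P.hasStrictDerivAt_sheet t)

/-- The parity of `(a_v + b_v) / 2` is the same at all vertices. -/
theorem neg_one_zpow_eq (S : OrthodiskSurface A B) (hn : ∀ v, Nonempty (VertexChart P v)) (v w : Option (Fin n)) :
    (-1 : ℂ) ^ ((A.data v + B.data v) / 2) = (-1) ^ ((A.data w + B.data w) / 2) := by
  -- Both forms are odd under the involution, so `dh²` is invariant. Connectedness gives one sign on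
  -- the whole half-plane, and this sign is visible near every vertex.
  have hsign : ∃ ε : ℂ, ∀ t ∈ upperHalf, S.dh (P.swap (P.sheet t)) = ε * S.dh (P.sheet t) := by
    rcases isPreconnected_upperHalf.eq_or_eq_neg_of_sq_eq
      (f := fun t => S.dh (P.swap (P.sheet t))) (g := fun t => S.dh (P.sheet t))
      (fun t ht => (S.continuousAt_dh_swap_sheet ht).continuousWithinAt)
      (fun t ht => (S.continuousAt_dh_sheet ht).continuousWithinAt)
      (fun t ht => by
        have h := P.sheet_snd_ne_zero ht
        simp only [Pi.pow_apply]
        rw [S.dh_sq h, S.dh_sq (show (P.swap (P.sheet t)).1.2 ≠ 0 from neg_ne_zero.mpr h),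
          A.form_swap, B.form_swap]
        ring)
      (fun {t} ht => S.dh_ne_zero (P.sheet_snd_ne_zero ht)) with h | h
    · exact ⟨1, fun t ht => by rw [one_mul]; exact h ht⟩
    · exact ⟨-1, fun t ht => by rw [neg_one_mul]; exact h ht⟩
  obtain ⟨ε, hε⟩ := hsign
  have key : ∀ v, (-1 : ℂ) ^ ((A.data v + B.data v) / 2) = ε := by
    intro v
    obtain ⟨C⟩ := hn v
    have := P.boundaryFilter_neBot v
    obtain ⟨t, ht, h⟩ := ((P.eventually_mem_upperHalf v).and
      ((P.tendsto_sheet v).eventually (S.eventually_dh_swap C))).exists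
    rw [hε t ht] at h
    exact (mul_right_cancel₀ (S.dh_ne_zero (P.sheet_snd_ne_zero ht)) h).symm
  rw [key, key]

theorem add_data_emod_four (S : OrthodiskSurface A B) (hn : ∀ v, Nonempty (VertexChart P v)) {u : Option (Fin n)}
    (hu : (A.data u + B.data u) % 4 = 0) (v : Option (Fin n)) :
    (A.data v + B.data v) % 4 = 0 := by
  have h1 := S.neg_one_zpow_eq hn v u
  have h2 : Even ((A.data u + B.data u) / 2) := by
    rw [Int.even_iff]; omega
  rw [h2.neg_one_zpow] at h1
  have h3 : Even ((A.data v + B.data v) / 2) := by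
    by_contra h
    rw [Int.not_even_iff_odd] at h
    rw [h.neg_one_zpow] at h1
    norm_num at h1
  rw [Int.even_iff] at h3
  have h4 := Int.odd_iff.mp (A.odd_data v)
  have h5 := Int.odd_iff.mp (B.odd_data v)
  omega

/-- The height differential on the sheet over the upper half-plane. -/
theorem exists_dh_sheet_eq (h4 : ∀ i, (A.data (some i) + B.data (some i)) % 4 = 0) :
    ∃ c : ℂ, c ≠ 0 ∧ ∀ t ∈ upperHalf, S.dh (P.sheet t) =
      c * ∏ i, (t - (P.t i : ℂ)) ^ ((A.data (some i) + B.data (some i)) / 4) := by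
  obtain ⟨c, hc⟩ : ∃ c : ℂ, c ^ 2 = S.c₁ * S.c₂ :=
    ⟨_, Complex.cpow_nat_inv_pow _ two_ne_zero⟩
  have hc0 : c ≠ 0 := by
    rintro rfl
    rw [zero_pow two_ne_zero] at hc
    exact mul_ne_zero S.c₁_ne_zero S.c₂_ne_zero hc.symm
  have hprod : ∀ t ∈ upperHalf,
      ∏ i, (t - (P.t i : ℂ)) ^ ((A.data (some i) + B.data (some i)) / 4) ≠ 0 := fun t ht =>
    Finset.prod_ne_zero_iff.mpr fun i _ => zpow_ne_zero _ (P.sub_ne_zero_of_mem_upperHalf ht i)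
  rcases isPreconnected_upperHalf.eq_or_eq_neg_of_sq_eq
    (f := fun t => S.dh (P.sheet t)) (g := fun t =>
      c * ∏ i, (t - (P.t i : ℂ)) ^ ((A.data (some i) + B.data (some i)) / 4))
    (fun t ht => (S.continuousAt_dh_sheet ht).continuousWithinAt)
    (fun t ht => (continuousAt_const.mul (tendsto_finsetProd _ fun i _ =>
      ContinuousAt.zpow₀ (by fun_prop) _
        (Or.inl (P.sub_ne_zero_of_mem_upperHalf ht i)))).continuousWithinAt)
    (fun t ht => by
      have h := P.sheet_snd_ne_zero ht
      simp only [Pi.pow_apply]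
      rw [S.dh_sq h, mul_pow, hc, mul_mul_mul_comm, A.form_mul_form B h4 h]
      rfl)
    (fun {t} ht => mul_ne_zero hc0 (hprod t ht)) with h | h
  · exact ⟨c, hc0, fun t ht => h ht⟩
  · exact ⟨-c, neg_ne_zero.mpr hc0, fun t ht => by rw [neg_mul]; exact h ht⟩

theorem exists_height_eq {L D : ℂ → ℂ} {c : ℂ}
    (hL : ∀ t ∈ upperHalf, HasDerivAt L (D t) t)
    (hD : ∀ t ∈ upperHalf, S.dh (P.sheet t) = c * D t) :
    ∃ κ : ℝ, ∀ t ∈ upperHalf,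
      S.X (P.sheet t : OnePoint P.AffineCurve) 2 = (c * L t).re + κ := by
  have h : ∀ t ∈ upperHalf, HasFDerivAt
      (fun t => S.X (P.sheet t : OnePoint P.AffineCurve) 2 - (c * L t).re) (0 : ℂ →L[ℝ] ℝ) t := by
    intro t ht
    have h1 := (S.hasFDerivAt_comp (P.sheet_snd_ne_zero ht) one_ne_zero (P.continuousAt_sheet ht)
      (P.hasStrictDerivAt_sheet t)).2.2
    have h2 := ((hL t ht).const_mul c).hasFDerivAt_re
    refine (h1.sub h2).congr_fderiv ?_
    rw [mul_one, hD t ht, sub_self]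
  obtain ⟨κ, hκ⟩ := isOpen_upperHalf.exists_is_const_of_fderiv_eq_zero (𝕜 := ℝ)
    isPreconnected_upperHalf (fun t ht => (h t ht).differentiableAt.differentiableWithinAt)
    (fun t ht => (h t ht).fderiv)
  exact ⟨κ, fun t ht => by have := hκ t ht; linarith⟩

/-- The growth rate of an embedded end can be read off from the height over the upper
half-plane. -/
theorem exists_tendsto_height_add {v : Option (Fin n)} {α β γ : ℝ}
    (h : IsEmbeddedEnd S.X (P.vertexPoint v) verticalUnit α β)
    (hγ : Tendsto (fun z : P.AffineCurve =>
        Real.log ‖horizontalPart verticalUnit (S.X (z : OnePoint P.AffineCurve))‖ +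
          1 / 2 * Real.log (P.size v z.1.1)) (P.vertexFilter v) (𝓝 γ)) :
    Tendsto (fun t => S.X (P.sheet t : OnePoint P.AffineCurve) 2 +
      α / 2 * Real.log (P.size v t)) (P.boundaryFilter v) (𝓝 (β + α * γ)) := by
  have h1 := h.2.2
  rw [← P.map_vertexFilter, tendsto_map'_iff] at h1
  refine ((h1.comp (P.tendsto_sheet v)).add ((hγ.comp (P.tendsto_sheet v)).const_mul α)).congr
    fun t => ?_
  simp only [Function.comp_apply, inner_verticalUnit, sheet_fst]
  ring

end OrthodiskSurface

/-! ### The dipole potential with poles at two vertices -/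

namespace ConformalPolygon

variable {n : ℕ} (P : ConformalPolygon n)

/-- The primitive, on the upper half-plane, of a form with simple poles at the vertices `t_i`
and `q`. -/
noncomputable def dipole (i : Fin n) : Option (Fin n) → ℂ → ℂ
  | none, t => Complex.log (t - P.t i)
  | some j, t => Complex.log (t - P.t i) - Complex.log (P.t j - t)

/-- The derivative of `dipole`. -/
noncomputable def dipoleForm (i : Fin n) : Option (Fin n) → ℂ → ℂ
  | none, t => (t - P.t i)⁻¹
  | some j, t => (t - P.t i)⁻¹ + (P.t j - t)⁻¹

/-- The value of `Re dipole` at a vertex. -/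
noncomputable def dipoleValue (i : Fin n) (q : Option (Fin n)) : Option (Fin n) → ℝ
  | none => 0
  | some l => (P.dipole i q (P.t l)).re

theorem hasDerivAt_dipole (i : Fin n) (q : Option (Fin n)) {t : ℂ} (ht : t ∈ upperHalf) :
    HasDerivAt (P.dipole i q) (P.dipoleForm i q t) t := by
  have h1 : HasDerivAt (fun t : ℂ => Complex.log (t - P.t i)) (t - P.t i)⁻¹ t := by
    simpa using ((hasDerivAt_id t).sub_const (P.t i : ℂ)).clog (sub_ofReal_mem_slitPlane ht _)
  cases q with
  | none => exact h1
  | some j =>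
    have h2 : HasDerivAt (fun t : ℂ => Complex.log (P.t j - t)) (-(P.t j - t)⁻¹) t := by
      have := ((hasDerivAt_id t).const_sub (P.t j : ℂ)).clog (ofReal_sub_mem_slitPlane ht _)
      refine this.congr_deriv ?_
      rw [neg_div, one_div]; rfl
    exact (h1.sub h2).congr_deriv (sub_neg_eq_add _ _)

/-- Partial fractions: `1 / ((t - t_i)(t - t_j))` is a multiple of `1 / (t - t_i) + 1 / (t_j - t)`.
If `q = ∞`, only the factor at `t_i` remains. -/
theorem exists_prod_eq_dipoleForm {i : Fin n} {q : Option (Fin n)} (hiq : some i ≠ q)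
    {e : Option (Fin n) → ℤ} (he : ∀ v, e v = if v = some i ∨ v = q then -1 else 0) :
    ∃ c : ℂ, c ≠ 0 ∧ ∀ t ∈ upperHalf,
      ∏ l, (t - (P.t l : ℂ)) ^ e (some l) = c * P.dipoleForm i q t := by
  cases q with
  | none =>
    refine ⟨1, one_ne_zero, fun t ht => ?_⟩
    rw [Finset.prod_eq_single i (fun l _ hl => by simp [he, hl]) (by simp)]
    simp [he, dipoleForm]
  | some j =>
    have hij : i ≠ j := fun h => hiq (by rw [h])
    have hne : (P.t j : ℂ) - P.t i ≠ 0 := by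
      rw [sub_ne_zero]
      exact_mod_cast P.strictMono_t.injective.ne hij.symm
    refine ⟨-((P.t j : ℂ) - P.t i)⁻¹, neg_ne_zero.mpr (inv_ne_zero hne), fun t ht => ?_⟩
    rw [Finset.prod_eq_mul i j hij (fun l _ hl => by simp [he, hl.1, hl.2]) (by simp) (by simp)]
    have h1 := P.sub_ne_zero_of_mem_upperHalf ht i
    have h2 := P.sub_ne_zero_of_mem_upperHalf ht j
    have h3 : (P.t j : ℂ) - t ≠ 0 := by rw [← neg_sub]; exact neg_ne_zero.mpr h2
    simp only [he, true_or, or_true, if_true, zpow_neg_one, dipoleForm]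
    rw [← neg_sub (P.t j : ℂ) t]
    field_simp
    ring

theorem tendsto_log_norm_sub_sub (a b : ℂ) :
    Tendsto (fun t : ℂ => Real.log ‖t - a‖ - Real.log ‖t - b‖) (Bornology.cobounded ℂ) (𝓝 0) := by
  have key : ∀ a : ℂ, Tendsto (fun t : ℂ => Real.log ‖1 - a * t⁻¹‖) (Bornology.cobounded ℂ) (𝓝 0) := by
    intro a
    have h1 : Tendsto (fun t : ℂ => ‖1 - a * t⁻¹‖) (Bornology.cobounded ℂ) (𝓝 1) := by
      have := (tendsto_const_nhds (x := (1 : ℂ))).sub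
        ((tendsto_inv₀_cobounded (α := ℂ)).const_mul a) |>.norm
      simpa using this
    simpa using h1.log one_ne_zero
  have h := (key a).sub (key b)
  rw [sub_zero] at h
  refine h.congr' ?_
  filter_upwards [Bornology.eventually_ne_cobounded 0, Bornology.eventually_ne_cobounded a,
    Bornology.eventually_ne_cobounded b] with t h0 ha hb
  have hfac : ∀ c : ℂ, t ≠ c → Real.log ‖1 - c * t⁻¹‖ = Real.log ‖t - c‖ - Real.log ‖t‖ := by
    intro c hc
    rw [← Real.log_div (norm_ne_zero_iff.mpr (sub_ne_zero.mpr hc)) (norm_ne_zero_iff.mpr h0),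
      ← norm_div, sub_div, div_self h0, div_eq_mul_inv]
  rw [hfac a ha, hfac b hb]
  ring

theorem continuousAt_log_norm_sub {a b : ℂ} (h : b ≠ a) :
    ContinuousAt (fun t : ℂ => Real.log ‖t - a‖) b :=
  ContinuousAt.log (by fun_prop) (norm_ne_zero_iff.mpr (sub_ne_zero.mpr h))

theorem re_dipole_none (i : Fin n) (t : ℂ) :
    (P.dipole i none t).re = Real.log ‖t - P.t i‖ := by
  simp [dipole, Complex.log_re]

theorem re_dipole_some (i j : Fin n) (t : ℂ) :
    (P.dipole i (some j) t).re = Real.log ‖t - P.t i‖ - Real.log ‖t - P.t j‖ := by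
  simp [dipole, Complex.log_re, norm_sub_rev t (P.t j : ℂ)]

theorem t_ne {i l : Fin n} (h : l ≠ i) : (P.t l : ℂ) ≠ P.t i := by
  exact_mod_cast P.strictMono_t.injective.ne h

theorem tendsto_re_dipole {i : Fin n} {q v : Option (Fin n)} (hvi : v ≠ some i) (hvq : v ≠ q) :
    Tendsto (fun t => (P.dipole i q t).re) (P.boundaryFilter v) (𝓝 (P.dipoleValue i q v)) := by
  cases v with
  | none =>
    cases q with
    | none => exact absurd rfl hvq
    | some j =>
      simp only [re_dipole_some]
      exact tendsto_inf_left (tendsto_log_norm_sub_sub _ _)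
  | some l =>
    have hli : l ≠ i := fun h => hvi (by rw [h])
    refine Tendsto.mono_left ?_ nhdsWithin_le_nhds
    cases q with
    | none =>
      simp only [dipoleValue, re_dipole_none]
      exact continuousAt_log_norm_sub (P.t_ne hli)
    | some j =>
      have hlj : l ≠ j := fun h => hvq (by rw [h])
      simp only [dipoleValue, re_dipole_some]
      exact (continuousAt_log_norm_sub (P.t_ne hli)).sub (continuousAt_log_norm_sub (P.t_ne hlj))

theorem exists_tendsto_re_dipole_add {i : Fin n} {q : Option (Fin n)} (hiq : some i ≠ q) :
    ∃ c, Tendsto (fun t => (P.dipole i q t).re + Real.log (P.size q t)) (P.boundaryFilter q)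
      (𝓝 c) := by
  cases q with
  | none =>
    refine ⟨0, tendsto_inf_left ((tendsto_log_norm_sub_sub (P.t i) 0).congr fun t => ?_)⟩
    rw [re_dipole_none, size, Real.log_inv, sub_zero, sub_eq_add_neg]
  | some j =>
    have hji : j ≠ i := fun h => hiq (by rw [h])
    refine ⟨_, Tendsto.mono_left ((continuousAt_log_norm_sub (P.t_ne hji)).tendsto.congr fun t => ?_)
      nhdsWithin_le_nhds⟩
    rw [re_dipole_some, size]
    ring

/-- The coefficient of `dipole` is real if its real part has a limit up to a multiple of
`log ‖t - t_i‖`. -/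
theorem im_eq_zero_of_tendsto_dipole {i : Fin n} {q : Option (Fin n)}
    (hq : ∀ j, q = some j → P.t i < P.t j) {k : ℂ} {κ a δ : ℝ}
    (h : Tendsto (fun t => (k * P.dipole i q t).re + κ + a * Real.log ‖t - P.t i‖)
      (𝓝[upperHalf] (P.t i : ℂ)) (𝓝 δ)) : k.im = 0 ∧ k.re + a = 0 := by
  obtain ⟨Λ, hΛ⟩ : ∃ Λ : ℝ, Tendsto (fun t : ℂ => (k * Complex.log (t - P.t i)).re +
      a * Real.log ‖t - P.t i‖) (𝓝[upperHalf] (P.t i : ℂ)) (𝓝 Λ) := by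
    cases q with
    | none => exact ⟨δ - κ, (h.sub_const κ).congr fun t => by simp only [dipole]; ring⟩
    | some j =>
      -- Here the order `t_i < t_j` and the choice of `log (t_j - t)` matter: this term is
      -- continuous at `t_i` and can be removed.
      have hij : (P.t j : ℂ) - P.t i ∈ Complex.slitPlane := by
        rw [← Complex.ofReal_sub]
        exact Complex.ofReal_mem_slitPlane.mpr (sub_pos.mpr (hq j rfl))
      have h1 : ContinuousAt (fun t : ℂ => (k * Complex.log (P.t j - t)).re) (P.t i) :=
        Complex.continuous_re.continuousAt.comp
          (continuousAt_const.mul (ContinuousAt.clog (by fun_prop) hij))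
      exact ⟨_, ((h.sub_const κ).add (h1.tendsto.mono_left nhdsWithin_le_nhds)).congr fun t => by
        simp only [dipole, mul_sub, Complex.sub_re]; ring⟩
  -- On the ray of angle `θ` the term `-k.im * θ` appears, but the limit does not depend on `θ`.
  -- Comparing two angles kills `k.im`; then the coefficient of `log ρ` must vanish.
  have hray : ∀ θ : ℝ, 0 < θ → θ < Real.pi →
      Tendsto (fun ρ : ℝ => (k.re + a) * Real.log ρ - k.im * θ) (𝓝[>] 0) (𝓝 Λ) := by
    intro θ h0 hπ
    refine (hΛ.comp (tendsto_ray (P.t i) h0 hπ)).congr' ?_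
    filter_upwards [self_mem_nhdsWithin] with ρ hρ
    have hρ' : 0 < ρ := hρ
    have hlog : Complex.log (ρ * Complex.exp (θ * Complex.I)) = Real.log ρ + θ * Complex.I := by
      rw [Complex.log_ofReal_mul hρ' (Complex.exp_ne_zero _), Complex.log_exp]
      · simpa using by linarith
      · simpa using hπ.le
    simp only [Function.comp_apply, add_sub_cancel_left, norm_mul, Complex.norm_exp_ofReal_mul_I,
      Complex.norm_real, Real.norm_eq_abs, abs_of_pos hρ', hlog, mul_one]
    simp
    ring
  have h3 := Real.pi_gt_three
  have h1 := hray 1 one_pos (by linarith)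
  have h2 := hray 2 two_pos (by linarith)
  have him : k.im = 0 := by
    have h4 := (h1.sub h2).congr (fun ρ => show _ = k.im by ring)
    rw [sub_self] at h4
    exact tendsto_nhds_unique tendsto_const_nhds h4
  refine ⟨him, eq_zero_of_tendsto_mul Real.tendsto_log_nhdsGT_zero (h1.congr fun ρ => ?_)⟩
  rw [him]; ring

/-- `Re dipole` separates the vertices in a component of the complement of its two poles in the
circle `ℝ ∪ {∞}`. -/
theorem eq_of_dipoleValue_eq {i : Fin n} {q v w : Option (Fin n)}
    (hq : ∀ j, q = some j → P.t i < P.t j)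
    (hw : P.boundaryPoint w ∈ connectedComponentIn
      ({P.boundaryPoint (some i), P.boundaryPoint q} : Set (OnePoint ℝ))ᶜ (P.boundaryPoint v))
    (h : P.dipoleValue i q v = P.dipoleValue i q w) : v = w := by
  set T : Set (OnePoint ℝ) := {P.boundaryPoint (some i), P.boundaryPoint q}ᶜ with hT
  have hvT : P.boundaryPoint v ∈ T := by
    by_contra hv
    rw [connectedComponentIn_eq_empty hv] at hw
    exact hw
  have hwT : P.boundaryPoint w ∈ T := connectedComponentIn_subset _ _ hw
  have hvv := mem_connectedComponentIn hvT
  have hpre : IsPreconnected (connectedComponentIn T (P.boundaryPoint v)) :=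
    isPreconnected_connectedComponentIn
  have hmem : ∀ {u}, P.boundaryPoint u ∈ T → u ≠ some i ∧ u ≠ q := by
    intro u hu
    refine ⟨?_, ?_⟩ <;> rintro rfl <;> simp [hT] at hu
  have hnorm : ∀ l m : Fin n, ‖(P.t l : ℂ) - P.t m‖ = |P.t l - P.t m| := fun l m => by
    rw [← Complex.ofReal_sub, Complex.norm_real, Real.norm_eq_abs]
  have hne : ∀ {l m : Fin n}, some l ≠ some m → P.t l - P.t m ≠ 0 := fun h =>
    sub_ne_zero.mpr (P.strictMono_t.injective.ne fun h' => h (congrArg some h'))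
  have hvn := hmem hvT
  have hwn := hmem hwT
  cases q with
  | none =>
    obtain ⟨l, rfl⟩ := Option.ne_none_iff_exists'.mp hvn.2
    obtain ⟨m, rfl⟩ := Option.ne_none_iff_exists'.mp hwn.2
    have hsub := hpre.subset_or_subset (OnePoint.isOpen_image_coe.mpr (isOpen_Iio (a := P.t i)))
      (OnePoint.isOpen_image_coe.mpr (isOpen_Ioi (a := P.t i)))
      ((Set.disjoint_image_iff OnePoint.coe_injective).mpr
        (Set.disjoint_left.mpr fun x h1 h2 => lt_asymm (Set.mem_Iio.mp h1) h2))
      ((connectedComponentIn_subset _ _).trans fun x hx => by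
        induction x using OnePoint.rec with
        | infty => simp [hT, boundaryPoint] at hx
        | coe x =>
          have hxi : x ≠ P.t i := by rintro rfl; simp [hT, boundaryPoint] at hx
          rcases lt_or_gt_of_ne hxi with h | h
          · exact Or.inl ⟨x, h, rfl⟩
          · exact Or.inr ⟨x, h, rfl⟩)
    simp only [dipoleValue, re_dipole_none, hnorm] at h
    have habs := Real.log_injOn_pos (Set.mem_Ioi.mpr (abs_pos.mpr (hne hvn.1)))
      (Set.mem_Ioi.mpr (abs_pos.mpr (hne hwn.1))) h
    have hlm : P.t l = P.t m := by
      rcases hsub with hs | hs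
      · obtain ⟨x, hx, hxl⟩ := hs hvv
        obtain ⟨y, hy, hym⟩ := hs hw
        rw [OnePoint.coe_injective hxl] at hx
        rw [OnePoint.coe_injective hym] at hy
        rw [abs_of_neg (sub_neg.mpr hx), abs_of_neg (sub_neg.mpr hy)] at habs
        linarith
      · obtain ⟨x, hx, hxl⟩ := hs hvv
        obtain ⟨y, hy, hym⟩ := hs hw
        rw [OnePoint.coe_injective hxl] at hx
        rw [OnePoint.coe_injective hym] at hy
        rw [abs_of_pos (sub_pos.mpr hx), abs_of_pos (sub_pos.mpr hy)] at habs
        linarith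
    exact congrArg some (P.strictMono_t.injective hlm)
  | some j =>
    have hij := hq j rfl
    -- The two arcs are the open interval between the poles and the complement of the closed one,
    -- which contains `∞`.
    have hsub := hpre.subset_or_subset
      (OnePoint.isOpen_image_coe.mpr (isOpen_Ioo (a := P.t i) (b := P.t j)))
      (OnePoint.isOpen_compl_image_coe.mpr
        ⟨isClosed_Icc (a := P.t i) (b := P.t j), isCompact_Icc⟩)
      (Set.disjoint_compl_right_iff_subset.mpr (Set.image_mono Set.Ioo_subset_Icc_self))
      ((connectedComponentIn_subset _ _).trans fun x hx => by
        by_cases hxI : x ∈ (fun x : ℝ => (x : OnePoint ℝ)) '' Set.Icc (P.t i) (P.t j)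
        · obtain ⟨y, hy, rfl⟩ := hxI
          refine Or.inl ⟨y, ⟨lt_of_le_of_ne hy.1 ?_, lt_of_le_of_ne hy.2 ?_⟩, rfl⟩
          · rintro rfl; simp [hT, boundaryPoint] at hx
          · rintro rfl; simp [hT, boundaryPoint] at hx
        · exact Or.inr hxI)
    -- the cross ratio whose logarithm is the real part of the dipole
    let f : Option (Fin n) → ℝ := fun u => u.elim (-1) fun l => (P.t l - P.t i) / (P.t j - P.t l)
    have hval : ∀ u, u ≠ some i → u ≠ some j → P.dipoleValue i (some j) u = Real.log |f u| ∧ f u ≠ 0 := by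
      intro u h1 h2
      cases u with
      | none => simp [f, dipoleValue]
      | some l =>
        have h3 := hne h1
        have h4 := hne h2.symm
        refine ⟨?_, div_ne_zero h3 h4⟩
        simp only [dipoleValue, re_dipole_some, hnorm, f, Option.elim_some]
        rw [abs_div, Real.log_div (abs_ne_zero.mpr h3) (abs_ne_zero.mpr h4), abs_sub_comm (P.t j)]
    obtain ⟨hv1, hv2⟩ := hval v hvn.1 hvn.2
    obtain ⟨hw1, hw2⟩ := hval w hwn.1 hwn.2
    rw [hv1, hw1] at h
    have habs := Real.log_injOn_pos (Set.mem_Ioi.mpr (abs_pos.mpr hv2))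
      (Set.mem_Ioi.mpr (abs_pos.mpr hw2)) h
    -- The function `f` is positive on the inner arc and negative on the outer one, with its limit
    -- `-1` as value at `∞`. On a single arc `|f|` thus determines `f`, and `f` is injective as a
    -- Möbius map.
    have hpos : ∀ u, P.boundaryPoint u ∈ (fun x : ℝ => (x : OnePoint ℝ)) '' Set.Ioo (P.t i) (P.t j) →
        0 < f u := by
      rintro u ⟨x, hx, hxu⟩
      cases u with
      | none => exact absurd hxu (OnePoint.coe_ne_infty _)
      | some l =>
        rw [OnePoint.coe_injective hxu] at hx
        exact div_pos (sub_pos.mpr hx.1) (sub_pos.mpr hx.2)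
    have hneg : ∀ u, P.boundaryPoint u ∈
        ((fun x : ℝ => (x : OnePoint ℝ)) '' Set.Icc (P.t i) (P.t j))ᶜ → f u < 0 := by
      intro u hu
      cases u with
      | none => simp [f]
      | some l =>
        have hl : ¬ (P.t i ≤ P.t l ∧ P.t l ≤ P.t j) := fun hl => hu ⟨P.t l, hl, rfl⟩
        rcases lt_or_ge (P.t l) (P.t i) with h1 | h1
        · exact div_neg_of_neg_of_pos (sub_neg.mpr h1) (sub_pos.mpr (h1.trans hij))
        · have h2 : P.t j < P.t l := by
            by_contra h2
            exact hl ⟨h1, not_lt.mp h2⟩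
          exact div_neg_of_pos_of_neg (sub_pos.mpr (hij.trans h2)) (sub_neg.mpr h2)
    have hf : f v = f w := by
      rcases hsub with hs | hs
      · rwa [abs_of_pos (hpos v (hs hvv)), abs_of_pos (hpos w (hs hw))] at habs
      · rw [abs_of_neg (hneg v (hs hvv)), abs_of_neg (hneg w (hs hw))] at habs
        exact neg_injective habs
    cases v with
    | none =>
      cases w with
      | none => rfl
      | some m =>
        have h4 := hne hwn.2.symm
        simp only [f, Option.elim_some, Option.elim_none] at hf
        rw [eq_div_iff h4] at hf
        linarith
    | some l =>
      have h5 := hne hvn.2.symm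
      cases w with
      | none =>
        simp only [f, Option.elim_some, Option.elim_none] at hf
        rw [div_eq_iff h5] at hf
        linarith
      | some m =>
        have h4 := hne hwn.2.symm
        simp only [f, Option.elim_some] at hf
        rw [div_eq_div_iff h5 h4] at hf
        have h6 : (P.t j - P.t i) * (P.t l - P.t m) = 0 := by linear_combination hf
        rcases mul_eq_zero.mp h6 with h7 | h7
        · linarith
        · exact congrArg some (P.strictMono_t.injective (sub_eq_zero.mp h7))

/-- A normalization: at least one of the two vertices is finite, and the first one is taken finite
and to the left of the other if that is finite too. -/
theorem exists_ordered_pair {v w : Option (Fin n)} (h : v ≠ w) :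
    ∃ (i : Fin n) (q : Option (Fin n)), ({v, w} : Set (Option (Fin n))) = {some i, q} ∧
      some i ≠ q ∧ ∀ j, q = some j → P.t i < P.t j := by
  cases v with
  | none =>
    obtain ⟨i, rfl⟩ := Option.ne_none_iff_exists'.mp h.symm
    exact ⟨i, none, Set.pair_comm _ _, by simp, by simp⟩
  | some i =>
    cases w with
    | none => exact ⟨i, none, rfl, by simp, by simp⟩
    | some j =>
      have hij : i ≠ j := fun h' => h (congrArg some h')
      rcases lt_or_gt_of_ne hij with h1 | h1
      · exact ⟨i, some j, rfl, h, fun m hm => by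
          rw [← Option.some_injective _ hm]; exact P.strictMono_t h1⟩
      · exact ⟨j, some i, Set.pair_comm _ _, h.symm, fun m hm => by
          rw [← Option.some_injective _ hm]; exact P.strictMono_t h1⟩

end ConformalPolygon

/-! ### Classification of the vertices and the theorem -/

/-- Divisibility by four leaves the sums `-4`, `0` and `4`. Completeness excludes `{1, 3}`, and sum
`0` means `{-3, 3}` or the ordinary type `{-1, 1}`. -/
theorem Orthodisk.isCatenoidVertex_or_isPlanarVertex {n : ℕ} {P : ConformalPolygon n}
    {A B : Orthodisk P} {v : Option (Fin n)}
    (hA : A.data v ∈ ({-3, -1, 1, 3} : Set ℤ)) (hB : B.data v ∈ ({-3, -1, 1, 3} : Set ℤ))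
    (hc : 2 + A.data v + B.data v ≤ |A.data v - B.data v|)
    (h4 : (A.data v + B.data v) % 4 = 0) :
    IsCatenoidVertex A B v ∨ IsPlanarVertex A B v ∨
      (A.data v + B.data v = 0 ∧ ¬ IsEnd A B v) := by
  unfold IsCatenoidVertex IsPlanarVertex IsEnd
  simp only [Set.mem_insert_iff, Set.mem_singleton_iff] at hA hB
  rw [le_abs] at hc
  omega

theorem theorem9p2 {n : ℕ} {P : ConformalPolygon n} {A B : Orthodisk P}
    (S : OrthodiskSurface A B)
    (h_values : ∀ v, A.data v ∈ ({-3, -1, 1, 3} : Set ℤ) ∧ B.data v ∈ ({-3, -1, 1, 3} : Set ℤ))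
    (h_complete : ∀ v, 2 + A.data v + B.data v ≤ |A.data v - B.data v|)
    (h_parity : ∀ v, A.data v + B.data v ≡ 0 [ZMOD 2])
    (h_catenoid : {v | Orthodisk.IsCatenoidVertex A B v}.ncard = 2)
    (h_planar : ∀ v w, Orthodisk.IsPlanarVertex A B v → Orthodisk.IsPlanarVertex A B w →
      P.boundaryPoint w ∈ connectedComponentIn
        {x | ∃ u, Orthodisk.IsCatenoidVertex A B u ∧ P.boundaryPoint u = x}ᶜ
        (P.boundaryPoint v)) :
    S.EventuallyEmbedded ∧
      ∃ (ν : EuclideanSpace ℝ (Fin 3)) (v w : Option (Fin n)),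
        {u | Orthodisk.IsCatenoidVertex A B u} = {v, w} ∧
        S.IsCatenoidEndToward v ν ∧ S.IsCatenoidEndToward w (-ν) := by
  obtain ⟨p, q₀, hpq, hset⟩ := Set.ncard_eq_two.mp h_catenoid
  obtain ⟨i, q, hpair, hiq, hq⟩ := P.exists_ordered_pair hpq
  rw [hpair] at hset
  have hcat : ∀ v, Orthodisk.IsCatenoidVertex A B v ↔ v = some i ∨ v = q := fun v => by
    have := Set.ext_iff.mp hset v
    simpa using this
  have hchart : ∀ v, Nonempty (VertexChart P v) := fun v => by
    cases v with
    | none => exact P.nonempty_vertexChart_none A.odd_card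
    | some l => exact P.nonempty_vertexChart_some l
  have h4 : ∀ v, (A.data v + B.data v) % 4 = 0 :=
    S.add_data_emod_four hchart (u := some i) (by
      rcases (hcat (some i)).mpr (Or.inl rfl) with ⟨h1, h2⟩ | ⟨h1, h2⟩ <;> rw [h1, h2] <;> rfl)
  have hclass := fun v => Orthodisk.isCatenoidVertex_or_isPlanarVertex (h_values v).1 (h_values v).2
    (h_complete v) (h4 v)
  -- Planar vertices and ordinary points both have sum `0`, so `dh` has on the sheet only the two
  -- catenoid poles.
  have hexp : ∀ v, (A.data v + B.data v) / 4 = if v = some i ∨ v = q then -1 else 0 := by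
    intro v
    split_ifs with h
    · rcases (hcat v).mpr h with ⟨h1, h2⟩ | ⟨h1, h2⟩ <;> rw [h1, h2] <;> rfl
    · rcases hclass v with h1 | (⟨h1, h2⟩ | ⟨h1, h2⟩) | ⟨h1, -⟩
      · exact absurd ((hcat v).mp h1) h
      all_goals omega
  -- the height function on the upper half-plane
  obtain ⟨k, κ, hk0, hX⟩ : ∃ (k : ℂ) (κ : ℝ), k ≠ 0 ∧ ∀ t ∈ upperHalf,
      S.X (P.sheet t : OnePoint P.AffineCurve) 2 = (k * P.dipole i q t).re + κ := by
    obtain ⟨c, hc0, hc⟩ := S.exists_dh_sheet_eq fun l => h4 (some l)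
    obtain ⟨d, hd0, hd⟩ := P.exists_prod_eq_dipoleForm hiq hexp
    obtain ⟨κ, hκ⟩ := S.exists_height_eq (c := c * d) (fun t ht => P.hasDerivAt_dipole i q ht)
      (fun t ht => by rw [hc t ht, hd t ht, mul_assoc])
    exact ⟨c * d, κ, mul_ne_zero hc0 hd0, hκ⟩
  have hends : ∀ v, Orthodisk.IsEnd A B v → ∃ α β δ : ℝ, (A.data v + B.data v = 0 → α = 0) ∧
      IsEmbeddedEnd S.X (P.vertexPoint v) verticalUnit α β ∧
      (α = 0 → δ = β) ∧
      Tendsto (fun t => (k * P.dipole i q t).re + κ + α / 2 * Real.log (P.size v t))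
        (P.boundaryFilter v) (𝓝 δ) := by
    intro v hv
    obtain ⟨C⟩ := hchart v
    obtain ⟨α, hα, ⟨β, hβ⟩, γ, hγ⟩ := S.exists_isEmbeddedEnd C (by
      rcases hclass v with (⟨h1, h2⟩ | ⟨h1, h2⟩) | (⟨h1, h2⟩ | ⟨h1, h2⟩) | ⟨-, h1⟩
      · exact Or.inl ⟨h1, by omega⟩
      · exact Or.inr ⟨h2, by omega⟩
      · exact Or.inl ⟨h1, by omega⟩
      · exact Or.inr ⟨h2, by omega⟩
      · exact absurd hv h1)
    refine ⟨α, β, β + α * γ, hα, hβ, fun h => by rw [h]; ring,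
      (S.exists_tendsto_height_add hβ hγ).congr' ?_⟩
    filter_upwards [P.eventually_mem_upperHalf v] with t ht
    rw [hX t ht]
  choose! growth height limit hplanar hemb hlimit htends using hends
  have hend_of_cat : ∀ v, Orthodisk.IsCatenoidVertex A B v → Orthodisk.IsEnd A B v := by
    rintro v (⟨h1, h2⟩ | ⟨h1, h2⟩)
    · exact Or.inl (by omega)
    · exact Or.inr (by omega)
  have hi_end := hend_of_cat _ ((hcat (some i)).mpr (Or.inl rfl))
  have hq_end := hend_of_cat _ ((hcat q).mpr (Or.inr rfl))
  -- The pole at the finite vertex `t_i` gives both the reality of `k` and the growth rate there.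
  obtain ⟨him, hgi⟩ := P.im_eq_zero_of_tendsto_dipole hq (htends _ hi_end)
  have hre0 : k.re ≠ 0 := fun h => hk0 (Complex.ext h him)
  have hkre : ∀ t, (k * P.dipole i q t).re = k.re * (P.dipole i q t).re := fun t => by
    rw [Complex.mul_re, him, zero_mul, sub_zero]
  -- At `q` the dipole behaves like `-log size`, with the sign opposite to that at `t_i`.
  have hgq : growth q = 2 * k.re := by
    obtain ⟨c, hc⟩ := P.exists_tendsto_re_dipole_add hiq
    have := P.boundaryFilter_neBot q
    have h0 := eq_zero_of_tendsto_mul (a := growth q / 2 - k.re) (P.tendsto_log_size q)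
      (((htends q hq_end).sub ((hc.const_mul k.re).add_const κ)).congr fun t => by
        rw [hkre]; ring)
    linarith
  have hgi' : growth (some i) = -(2 * k.re) := by linarith
  have hgrowth_cat : ∀ v, Orthodisk.IsEnd A B v → growth v ≠ 0 → v = some i ∨ v = q := by
    intro v hv h0
    rcases hclass v with h1 | (⟨h1, h2⟩ | ⟨h1, h2⟩) | ⟨-, h1⟩
    · exact (hcat v).mp h1
    · exact absurd (hplanar v hv (by omega)) h0
    · exact absurd (hplanar v hv (by omega)) h0
    · exact absurd hv h1
  have hplanar_of_growth : ∀ v, Orthodisk.IsEnd A B v → growth v = 0 →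
      Orthodisk.IsPlanarVertex A B v ∧ height v = k.re * P.dipoleValue i q v + κ := by
    intro v hv h0
    have hvi : v ≠ some i := by
      rintro rfl
      rw [hgi'] at h0
      exact hre0 (by linarith)
    have hvq : v ≠ q := by
      rintro rfl
      rw [hgq] at h0
      exact hre0 (by linarith)
    refine ⟨?_, ?_⟩
    · rcases hclass v with h1 | h1 | ⟨-, h1⟩
      · exact absurd ((hcat v).mp h1) (by tauto)
      · exact h1
      · exact absurd hv h1
    · have := P.boundaryFilter_neBot v
      rw [← hlimit v hv h0]
      refine tendsto_nhds_unique (htends v hv)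
        ((((P.tendsto_re_dipole hvi hvq).const_mul k.re).add_const κ).congr fun t => ?_)
      rw [hkre, h0]
      ring
  have hcircle : {x | ∃ u, Orthodisk.IsCatenoidVertex A B u ∧ P.boundaryPoint u = x} =
      {P.boundaryPoint (some i), P.boundaryPoint q} := by
    change P.boundaryPoint '' {u | Orthodisk.IsCatenoidVertex A B u} = _
    rw [hset, Set.image_pair]
  refine ⟨⟨verticalUnit, norm_verticalUnit, growth, height, hemb, ?_, ?_⟩, ?_⟩
  · intro v w hv hw hvw hv0 hw0 hh
    obtain ⟨hvp, hvh⟩ := hplanar_of_growth v hv hv0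
    obtain ⟨hwp, hwh⟩ := hplanar_of_growth w hw hw0
    have hcomp := h_planar v w hvp hwp
    rw [hcircle] at hcomp
    refine hvw (P.eq_of_dipoleValue_eq hq hcomp (mul_left_cancel₀ hre0 ?_))
    linarith
  · intro v w hv hw hvw hsign heq
    have h1 := hgrowth_cat v hv (by rcases hsign with h | h; exacts [h.1.ne', h.1.ne])
    have h2 := hgrowth_cat w hw (by rcases hsign with h | h; exacts [h.2.ne', h.2.ne])
    rcases h1 with rfl | rfl <;> rcases h2 with rfl | rfl
    · exact hvw rfl
    · rw [hgi', hgq] at heq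
      exact hre0 (by linarith)
    · rw [hgi', hgq] at heq
      exact hre0 (by linarith)
    · exact hvw rfl
  -- The sign of `k` decides which of the two catenoid ends opens upwards.
  · rcases lt_or_gt_of_ne hre0 with h | h
    · exact ⟨verticalUnit, some i, q, hset,
        ⟨norm_verticalUnit, _, _, by rw [hgi']; linarith, hemb _ hi_end⟩,
        ⟨by rw [norm_neg, norm_verticalUnit], _, _, by rw [hgq]; linarith, (hemb _ hq_end).neg⟩⟩
    · refine ⟨-verticalUnit, some i, q, hset,
        ⟨by rw [norm_neg, norm_verticalUnit], _, _, ?_, (hemb _ hi_end).neg⟩, ?_⟩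
      · rw [hgi']; linarith
      · rw [neg_neg]
        exact ⟨norm_verticalUnit, _, _, by rw [hgq]; linarith, hemb _ hq_end⟩
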